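/- Let $R$ be a polynomial ring in finitely many variables over a field $K$, let $f_1,\dots,f_m\in R$, let $\le$ be a monomial order on $R$ (a multiplicative well-order of the monomials) and a compatible module monomial order on $R^m$ (a well-order of the module monomials with $S\le T\Rightarrow cS\le cT$ for monomials $c$, and $a\le b\iff ae_i\le be_i$). For $\alpha=\sum a_ie_i\in R^m$ put $\overline\alpha=\sum a_if_i$; the signature $\mathfrak s(\alpha)$ is the largest term of $\alpha$, with coefficient. Monomials may carry nonzero coefficients, and $\simeq$ is equality up to a nonzero scalar. Signatures are compared by $\le$ disregarding coefficients. *Reduction.* For $G\subseteq R^m$, a regular reduction step modulo $G$ replaces $\alpha$ by $\alpha-b\beta$, where $\beta\in G$, $b$ is a monomial, the lead term of $\overline{b\beta}$ equals some term of $\overline\alpha$ (lead or tail), $\mathfrak s(b\beta)\le\mathfrak s(\alpha)$ and $\mathfrak s(b\beta)\not\simeq\mathfrak s(\alpha)$. The result of regular reducing $\alpha$ is an element reached by such steps that admits no further one. $\gamma$ is singular top reducible modulo $G$ if there are $\beta\in G$ and a monomial $b$ such that the lead terms of $\overline{b\beta}$ and $\overline\gamma$ agree and $\mathfrak s(b\beta)\simeq\mathfrak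 s(\gamma)$. *S-pairs.* If $\overline\alpha,\overline\beta\ne0$ and $\lambda$ is the monic least common multiple of their lead terms, the S-pair of $\alpha,\beta$ is $a\alpha-b\beta$ with $a=\lambda/\mathrm{lt}(\overline\alpha)$, $b=\lambda/\mathrm{lt}(\overline\beta)$; it is regular if $\mathfrak s(a\alpha)\not\simeq\mathfrak s(b\beta)$. *genSB.* Start with $G=H=\emptyset$, $P=\{e_1,\dots,e_m\}$. While $P\neq\emptyset$, remove from $P$ an element of least signature and regular reduce it modulo $G$ to $\gamma$. If $\overline\gamma=0$, add $\gamma$ to $H$. Otherwise, if $\gamma$ is not singular top reducible modulo $G$, add to $P$ all regular S-pairs between elements of $G$ and $\gamma$, and then add $\gamma$ to $G$. Return $(G,H)$. *RB.* It has as additional input an order $\trianglelefteq$ on $G\cup H$. An element $\alpha\in G\cup H$ is a rewriter in signature $T$ if $\mathfrak s(a\alpha)=T$ for some monomial $a$; a multiple $a\alpha$ is rewritable if $\alpha$ is not $\trianglelefteq$-maximal among the rewriters in signature $\mathfrak s(a\alpha)$; an S-pair $a\alpha-b\beta$ is rewritable if $a\alpha$ or $b\beta$ is; the $e_i$ are not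 rewritable. RB starts with $G=\emptyset$, $H=\{f_ie_j-f_je_i : i<j\}$, $P=\{e_1,\dots,e_m\}$. While $P\ne\emptyset$, remove from $P$ an element of least signature. If it is rewritable, discard it; otherwise regular reduce it modulo $G$ to $\gamma$. If $\overline\gamma=0$, add $\gamma$ to $H$; otherwise add to $P$ all regular S-pairs between elements of $G$ and $\gamma$, and then add $\gamma$ to $G$. Return $(G,H)$. In both algorithms, ties between elements of $P$ of equal signature, and choices between reducers, may be resolved in any way. **Lemma.** Let $(G,H)$ be returned by genSB and $(G',H')$ by RB, for the same $f_1,\dots,f_m$ and the same $\le$. Assume that the order $\trianglelefteq$ used by RB is a rewrite order, i.e. a partial order on $G'\cup H'$ which is total on $G'$, and that it is admissible: whenever a regular S-pair $a\alpha-b\beta$ with $\alpha,\beta\in G'$ reduces by regular reduction steps modulo $G'$ to $\gamma\in G'$, then $\alpha\trianglelefteq\gamma$ if $\mathfrak s(a\alpha)>\mathfrak s(b\beta)$, and $\beta\trianglelefteq\gamma$ if $\mathfrak s(b\beta)>\mathfrak s(a\alpha)$. Then $G$ is a subset of $G'$ up to sig-poly pairs: for every $\alpha\in G$ there are $\beta\in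 G'$ and a nonzero $\kappa\in K$ with $\mathfrak s(\alpha)=\mathfrak s(\kappa\beta)$ and $\overline\alpha=\overline{\kappa\beta}$. -/

import Mathlib

noncomputable section

namespace SigGB

open MvPolynomial

/-- The free module `R ^ m` over the polynomial ring `R = K[σ]`. -/
abbrev FreeMod (σ K : Type*) [Field K] (m : ℕ) : Type _ := Fin m → MvPolynomial σ K

/-- A module monomial order on the free module of rank `m` over a polynomial ring, compatible with
the monomial order `ord`. The pair `(i, a)` stands for the monic module monomial `x ^ a * e_i`. -/
structure ModuleOrder {σ : Type*} (ord : MonomialOrder σ) (m : ℕ) where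
  /-- the strict order on monic module monomials -/
  lt : Fin m × (σ →₀ ℕ) → Fin m × (σ →₀ ℕ) → Prop
  isWellOrder : IsWellOrder (Fin m × (σ →₀ ℕ)) lt
  mul_lt : ∀ (c : σ →₀ ℕ) (i j : Fin m) (a b : σ →₀ ℕ),
    lt (i, a) (j, b) → lt (i, c + a) (j, c + b)
  compatible : ∀ (i : Fin m) (a b : σ →₀ ℕ), lt (i, a) (i, b) ↔ ord.toSyn a < ord.toSyn b

section Signatures

variable {σ K : Type*} [Field K] {m : ℕ} {ord : MonomialOrder σ}

/-- The monic module monomials, linearly ordered by `o`. -/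
def ModuleOrder.Mon (_o : ModuleOrder ord m) : Type _ := Fin m × (σ →₀ ℕ)

instance (o : ModuleOrder ord m) : LinearOrder o.Mon :=
  letI : IsWellOrder o.Mon o.lt := o.isWellOrder
  IsWellOrder.linearOrder (α := o.Mon) o.lt

/-- The monic module monomial `x ^ a * e_i`, as an element of the linear order `o.Mon`. -/
def ModuleOrder.mon (o : ModuleOrder ord m) (i : Fin m) (a : σ →₀ ℕ) : o.Mon := (i, a)

/-- The monic module monomial of the signature of `α` (`⊥` if `α = 0`): the largest one
that occurs in `α`. Inequalities between signatures are inequalities between these. -/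
def ModuleOrder.sigMon (o : ModuleOrder ord m) (α : FreeMod σ K m) : WithBot o.Mon :=
  Finset.univ.sup fun i => (α i).support.sup fun a => ((o.mon i a : o.Mon) : WithBot o.Mon)

/-- The signature of `α`: its largest term, with its coefficient (`0` if `α = 0`). -/
def ModuleOrder.sig (o : ModuleOrder ord m) (α : FreeMod σ K m) : FreeMod σ K m :=
  WithBot.recBotCoe (C := fun _ => FreeMod σ K m) 0
    (fun s : o.Mon => Pi.single s.1 (monomial s.2 ((α s.1).coeff s.2))) (o.sigMon α)

/-- `f ≃ g`: equality up to a nonzero scalar. -/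
def ScalarEq (K : Type*) [Field K] {M : Type*} [SMul K M] (x y : M) : Prop :=
  ∃ κ : K, κ ≠ 0 ∧ x = κ • y

/-- The homomorphism from the free module to `R` that sends `e_i` to `f_i`. -/
def proj (f : Fin m → MvPolynomial σ K) (α : FreeMod σ K m) : MvPolynomial σ K :=
  ∑ i, α i * f i

/-- `α` and `β` are equal up to sig-poly pairs. -/
def EqUpToSigPoly (f : Fin m → MvPolynomial σ K) (o : ModuleOrder ord m)
    (α β : FreeMod σ K m) : Prop :=
  ∃ κ : K, κ ≠ 0 ∧ o.sig α = o.sig (κ • β) ∧ proj f α = proj f (κ • β)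

/-! ### Reduction respecting signatures -/

/-- `t` is a term of the polynomial `p`. -/
def IsTermOf (t p : MvPolynomial σ K) : Prop :=
  ∃ d ∈ p.support, t = monomial d (p.coeff d)

/-- The multiple `bβ` reduces the term `t` of `proj f α`. -/
def SReducesTerm (f : Fin m → MvPolynomial σ K) (o : ModuleOrder ord m)
    (α : FreeMod σ K m) (t : MvPolynomial σ K) (bβ : FreeMod σ K m) : Prop :=
  IsTermOf t (proj f α) ∧ proj f bβ ≠ 0 ∧ ord.leadingTerm (proj f bβ) = t ∧
    o.sigMon bβ ≤ o.sigMon α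

/-- `bβ` is a multiple of `β` by a (not necessarily monic) monomial. -/
def IsMonomialMultiple (β bβ : FreeMod σ K m) : Prop :=
  ∃ (b : σ →₀ ℕ) (c : K), c ≠ 0 ∧ bβ = monomial b c • β

/-- One regular reduction step (top or tail) with respect to `G`, leading from `α` to `α'`. -/
def RegularStep (f : Fin m → MvPolynomial σ K) (o : ModuleOrder ord m)
    (G : Set (FreeMod σ K m)) (α α' : FreeMod σ K m) : Prop :=
  ∃ β ∈ G, ∃ bβ, IsMonomialMultiple β bβ ∧ (∃ t, SReducesTerm f o α t bβ) ∧
    ¬ ScalarEq K (o.sig bβ) (o.sig α) ∧ α' = α - bβ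

/-- `γ` is a result of regular reducing `α` with respect to `G`: it is reached by regular
reduction steps and admits no further one. -/
def IsRegularReduction (f : Fin m → MvPolynomial σ K) (o : ModuleOrder ord m)
    (G : Set (FreeMod σ K m)) (α γ : FreeMod σ K m) : Prop :=
  Relation.ReflTransGen (RegularStep f o G) α γ ∧ ∀ δ, ¬ RegularStep f o G γ δ

/-- `γ` is singular top reducible with respect to `G`. -/
def SingularTopReducible (f : Fin m → MvPolynomial σ K) (o : ModuleOrder ord m)
    (G : Set (FreeMod σ K m)) (γ : FreeMod σ K m) : Prop :=
  ∃ β ∈ G, ∃ bβ, IsMonomialMultiple β bβ ∧ (∃ t, SReducesTerm f o γ t bβ) ∧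
    ScalarEq K (ord.leadingTerm (proj f bβ)) (ord.leadingTerm (proj f γ)) ∧
    ScalarEq K (o.sig bβ) (o.sig γ)

/-! ### S-pairs -/

/-- The monomial `lcm (lt f, lt g) / lt f` for nonzero polynomials `f` and `g`, where
`lcm (lt f, lt g)` is the monic least common multiple of the lead terms. -/
def cofactor (ord : MonomialOrder σ) (f g : MvPolynomial σ K) : MvPolynomial σ K :=
  monomial (ord.degree f ⊔ ord.degree g - ord.degree f) (ord.leadingCoeff f)⁻¹

/-- The multiple of `α` that occurs in the S-pair of `α` and `β`. -/
def leg (f : Fin m → MvPolynomial σ K) (ord : MonomialOrder σ) (α β : FreeMod σ K m) :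
    FreeMod σ K m :=
  cofactor ord (proj f α) (proj f β) • α

/-- The S-pair of `α` and `β`. -/
def sPair (f : Fin m → MvPolynomial σ K) (ord : MonomialOrder σ) (α β : FreeMod σ K m) :
    FreeMod σ K m :=
  leg f ord α β - leg f ord β α

/-- The S-pair of `α` and `β` is regular. -/
def RegularPair (f : Fin m → MvPolynomial σ K) (o : ModuleOrder ord m)
    (α β : FreeMod σ K m) : Prop :=
  ¬ ScalarEq K (o.sig (leg f ord α β)) (o.sig (leg f ord β α))

/-- The entries of a pair set: unit vectors `e_i`, and S-pairs stored with their two generators. -/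
inductive Pair (σ K : Type*) [Field K] (m : ℕ) where
  | unit (i : Fin m) : Pair σ K m
  | spair (α β : FreeMod σ K m) : Pair σ K m

/-- The module element that an entry of a pair set stands for. -/
def Pair.val (f : Fin m → MvPolynomial σ K) (ord : MonomialOrder σ) :
    Pair σ K m → FreeMod σ K m
  | .unit i => Pi.single i 1
  | .spair α β => sPair f ord α β

/-- The regular S-pairs between elements of `G` and `γ`. -/
def newPairs (f : Fin m → MvPolynomial σ K) (o : ModuleOrder ord m)
    (G : Set (FreeMod σ K m)) (γ : FreeMod σ K m) : Set (Pair σ K m) :=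
  {p | ∃ α ∈ G, RegularPair f o α γ ∧ p = .spair α γ}

/-! ### The algorithms -/

/-- The values of the program variables: the basis `G`, the syzygies `H`, the pair set `P`. -/
structure State (σ K : Type*) [Field K] (m : ℕ) where
  G : Set (FreeMod σ K m)
  H : Set (FreeMod σ K m)
  P : Set (Pair σ K m)

/-- `p` may be chosen next from `P`, when `P` is handled by increasing signature. -/
def IsNext (f : Fin m → MvPolynomial σ K) (o : ModuleOrder ord m)
    (P : Set (Pair σ K m)) (p : Pair σ K m) : Prop :=
  p ∈ P ∧ ∀ q ∈ P, o.sigMon (p.val f ord) ≤ o.sigMon (q.val f ord)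

/-- One pass through the loop of `genSB`, with pairs handled by increasing signature. -/
inductive GenSBStep (f : Fin m → MvPolynomial σ K) (o : ModuleOrder ord m) :
    State σ K m → State σ K m → Prop
  | syzygy (s : State σ K m) (p : Pair σ K m) (γ : FreeMod σ K m) :
      IsNext f o s.P p → IsRegularReduction f o s.G (p.val f ord) γ → proj f γ = 0 →
      GenSBStep f o s ⟨s.G, s.H ∪ {γ}, s.P \ {p}⟩
  | basis (s : State σ K m) (p : Pair σ K m) (γ : FreeMod σ K m) :
      IsNext f o s.P p → IsRegularReduction f o s.G (p.val f ord) γ → proj f γ ≠ 0 →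
      ¬ SingularTopReducible f o s.G γ →
      GenSBStep f o s ⟨s.G ∪ {γ}, s.H, (s.P \ {p}) ∪ newPairs f o s.G γ⟩
  | singular (s : State σ K m) (p : Pair σ K m) (γ : FreeMod σ K m) :
      IsNext f o s.P p → IsRegularReduction f o s.G (p.val f ord) γ → proj f γ ≠ 0 →
      SingularTopReducible f o s.G γ →
      GenSBStep f o s ⟨s.G, s.H, s.P \ {p}⟩

/-- `(G, H)` is returned by a run of `genSB` (with some choice of ties between pairs of equal
signature and of reducers). -/
def GenSBReturns (f : Fin m → MvPolynomial σ K) (o : ModuleOrder ord m)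
    (G H : Set (FreeMod σ K m)) : Prop :=
  Relation.ReflTransGen (GenSBStep f o) ⟨∅, ∅, Set.range Pair.unit⟩ ⟨G, H, ∅⟩

/-- The elements of `G ∪ H` that have a monomial multiple of signature `T`. -/
def rewriters (o : ModuleOrder ord m) (G H : Set (FreeMod σ K m)) (T : FreeMod σ K m) :
    Set (FreeMod σ K m) :=
  {β | β ∈ G ∪ H ∧ ∃ bβ, IsMonomialMultiple β bβ ∧ o.sig bβ = T}

/-- `r` is a rewrite order on `G ∪ H`: a partial order on `G ∪ H` that is total on `G`. -/
def IsRewriteOrder (r : FreeMod σ K m → FreeMod σ K m → Prop)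
    (G H : Set (FreeMod σ K m)) : Prop :=
  (∀ α ∈ G ∪ H, r α α) ∧
  (∀ α ∈ G ∪ H, ∀ β ∈ G ∪ H, r α β → r β α → α = β) ∧
  (∀ α ∈ G ∪ H, ∀ β ∈ G ∪ H, ∀ γ ∈ G ∪ H, r α β → r β γ → r α γ) ∧
  (∀ α ∈ G, ∀ β ∈ G, r α β ∨ r β α)

/-- `r` is admissible on `G`: if the S-pair of `α, β ∈ G` regular reduces to `γ ∈ G`, then the
generator whose multiple carries the signature of the S-pair is below `γ`. -/
def IsAdmissible (f : Fin m → MvPolynomial σ K) (o : ModuleOrder ord m)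
    (r : FreeMod σ K m → FreeMod σ K m → Prop) (G : Set (FreeMod σ K m)) : Prop :=
  ∀ α ∈ G, ∀ β ∈ G, ∀ γ ∈ G, RegularPair f o α β →
    Relation.ReflTransGen (RegularStep f o G) (sPair f ord α β) γ →
    (o.sigMon (leg f ord β α) < o.sigMon (leg f ord α β) → r α γ) ∧
    (o.sigMon (leg f ord α β) < o.sigMon (leg f ord β α) → r β γ)

/-- `α` is the canonical (that is, `r`-maximal) rewriter in signature `T`. -/
def IsCanonicalRewriter (o : ModuleOrder ord m) (r : FreeMod σ K m → FreeMod σ K m → Prop)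
    (G H : Set (FreeMod σ K m)) (T α : FreeMod σ K m) : Prop :=
  α ∈ rewriters o G H T ∧ ∀ β ∈ rewriters o G H T, r α β → β = α

/-- The rewritability check of `RB`: an S-pair is rewritable if one of the two multiples in it is
rewritable. A unit vector has no generators to be checked. -/
def Pair.Rewritable (f : Fin m → MvPolynomial σ K) (o : ModuleOrder ord m)
    (r : FreeMod σ K m → FreeMod σ K m → Prop) (G H : Set (FreeMod σ K m)) :
    Pair σ K m → Prop
  | .unit _ => False
  | .spair α β =>
      ¬ IsCanonicalRewriter o r G H (o.sig (leg f ord α β)) α ∨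
      ¬ IsCanonicalRewriter o r G H (o.sig (leg f ord β α)) β

/-- One pass through the loop of `RB`, with pairs handled by increasing signature. -/
inductive RBStep (f : Fin m → MvPolynomial σ K) (o : ModuleOrder ord m)
    (r : FreeMod σ K m → FreeMod σ K m → Prop) : State σ K m → State σ K m → Prop
  | rewritten (s : State σ K m) (p : Pair σ K m) :
      IsNext f o s.P p → p.Rewritable f o r s.G s.H →
      RBStep f o r s ⟨s.G, s.H, s.P \ {p}⟩
  | syzygy (s : State σ K m) (p : Pair σ K m) (γ : FreeMod σ K m) :
      IsNext f o s.P p → ¬ p.Rewritable f o r s.G s.H →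
      IsRegularReduction f o s.G (p.val f ord) γ → proj f γ = 0 →
      RBStep f o r s ⟨s.G, s.H ∪ {γ}, s.P \ {p}⟩
  | basis (s : State σ K m) (p : Pair σ K m) (γ : FreeMod σ K m) :
      IsNext f o s.P p → ¬ p.Rewritable f o r s.G s.H →
      IsRegularReduction f o s.G (p.val f ord) γ → proj f γ ≠ 0 →
      RBStep f o r s ⟨s.G ∪ {γ}, s.H, (s.P \ {p}) ∪ newPairs f o s.G γ⟩

/-- The Koszul syzygies `f_i e_j - f_j e_i`, `i < j`. -/
def koszulSyzygies (f : Fin m → MvPolynomial σ K) : Set (FreeMod σ K m) :=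
  {α | ∃ i j, i < j ∧ α = Pi.single j (f i) - Pi.single i (f j)}

/-- `(G, H)` is returned by a run of `RB` with the order `r` in the rewritability check (with some
choice of ties between pairs of equal signature and of reducers). -/
def RBReturns (f : Fin m → MvPolynomial σ K) (o : ModuleOrder ord m)
    (r : FreeMod σ K m → FreeMod σ K m → Prop) (G H : Set (FreeMod σ K m)) : Prop :=
  Relation.ReflTransGen (RBStep f o r) ⟨∅, koszulSyzygies f, Set.range Pair.unit⟩ ⟨G, H, ∅⟩

end Signatures

end SigGB

end

/-!
The outputs of both algorithms are signature Gröbner bases, by one induction on the signature `T`.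
For each `T` not divisible by the signature of a known syzygy, a preferred multiple of a basis
element is singled out: one with least lead monomial for `genSB`, one that is not rewritten for
`RB`. Two preferred multiples with the same lead monomial but different signatures would form a
multiple of a regular S-pair, and the way the algorithm dealt with that S-pair contradicts the
preference for the multiple of larger signature (`genSB`) or for one of the two (`RB`). So a lead
monomial is preferred in at most one signature, and therefore preferred multiples are not regular
top reducible; by subtraction, every element of signature `T` is then top reducible.

Now let `γ ∈ G`. Its lead monomial is that of a multiple of some `β ∈ G'` of no larger signature,
and `β` is in turn top reducible by some `δ ∈ G`. As `γ` is regular reduced and was not singular top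
reducible, `δ`, `β` and `γ` have the same signature. After rescaling `β`, the difference `γ - β` has
smaller signature, so if its image were nonzero, its lead monomial would be regular reducible both
modulo `G` and modulo `G'`; but it occurs in the image of `γ` or of `β`, which are irreducible.
-/

noncomputable section

namespace SigGB

open MvPolynomial
open scoped MonomialOrder

section Signatures

variable {σ K : Type*} [Field K] {m : ℕ} {ord : MonomialOrder σ} (o : ModuleOrder ord m)

instance : WellFoundedLT o.Mon := ⟨o.isWellOrder.wf⟩

/-- Multiplication of module monomials by the monomials `x ^ b`, extended by `⊥` as the signature
of zero. -/
instance : AddAction (σ →₀ ℕ) (WithBot o.Mon) where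
  vadd b := WithBot.map fun s => o.mon s.1 (b + s.2)
  zero_vadd
    | ⊥ => rfl
    | (s : o.Mon) => congrArg (fun a => WithBot.some (o.mon s.1 a)) (zero_add s.2)
  add_vadd b c
    | ⊥ => rfl
    | (s : o.Mon) => congrArg (fun a => WithBot.some (o.mon s.1 a)) (add_assoc b c s.2)

lemma ModuleOrder.vadd_mon (b : σ →₀ ℕ) (i : Fin m) (a : σ →₀ ℕ) :
    b +ᵥ (o.mon i a : WithBot o.Mon) = o.mon i (b + a) :=
  rfl

lemma ModuleOrder.vadd_bot (b : σ →₀ ℕ) : b +ᵥ (⊥ : WithBot o.Mon) = ⊥ :=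
  rfl

lemma ModuleOrder.vadd_strictMono (b : σ →₀ ℕ) : StrictMono (b +ᵥ · : WithBot o.Mon → _) :=
  WithBot.strictMono_map_iff.2 fun s t => o.mul_lt b s.1 t.1 s.2 t.2

variable {o} in
lemma ModuleOrder.lt_vadd {b : σ →₀ ℕ} (hb : b ≠ 0) {T : WithBot o.Mon} (hT : T ≠ ⊥) :
    T < b +ᵥ T := by
  obtain ⟨⟨i, a⟩, rfl⟩ := WithBot.ne_bot_iff_exists.1 hT
  refine WithBot.coe_lt_coe.2 ((o.compatible i a (b + a)).2 ?_)
  rw [map_add]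
  exact lt_add_of_pos_left _ (ord.toSyn_lt_iff_ne_zero.2 (mt (ord.toSyn_eq_zero_iff b).1 hb))

lemma ModuleOrder.le_vadd (b : σ →₀ ℕ) (T : WithBot o.Mon) : T ≤ b +ᵥ T := by
  rcases eq_or_ne b 0 with rfl | hb
  · rw [zero_vadd]
  rcases eq_or_ne T ⊥ with rfl | hT
  · exact bot_le
  · exact (ModuleOrder.lt_vadd hb hT).le

variable {o} {α β : FreeMod σ K m}

lemma ModuleOrder.sigMon_le_iff {T : WithBot o.Mon} :
    o.sigMon α ≤ T ↔ ∀ i, ∀ a ∈ (α i).support, (o.mon i a : WithBot o.Mon) ≤ T := by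
  simp [ModuleOrder.sigMon, Finset.sup_le_iff]

lemma ModuleOrder.mon_le_sigMon {i : Fin m} {a : σ →₀ ℕ} (h : a ∈ (α i).support) :
    (o.mon i a : WithBot o.Mon) ≤ o.sigMon α :=
  ModuleOrder.sigMon_le_iff.1 le_rfl i a h

lemma ModuleOrder.exists_sigMon_eq_mon (h : o.sigMon α ≠ ⊥) :
    ∃ i, ∃ a ∈ (α i).support, o.sigMon α = o.mon i a := by
  by_contra! hne
  have hpos := bot_lt_iff_ne_bot.2 h
  have hlt : o.sigMon α < o.sigMon α :=
    (Finset.sup_lt_iff hpos).2 fun i _ => (Finset.sup_lt_iff hpos).2 fun a ha =>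
      (ModuleOrder.mon_le_sigMon ha).lt_of_ne (hne i a ha).symm
  exact lt_irrefl _ hlt

variable (o) in
lemma ModuleOrder.sigMon_zero : o.sigMon (0 : FreeMod σ K m) = ⊥ :=
  le_bot_iff.1 (ModuleOrder.sigMon_le_iff.2 fun i a ha => by simp at ha)

lemma ModuleOrder.sigMon_eq_bot : o.sigMon α = ⊥ ↔ α = 0 := by
  refine ⟨fun h => ?_, fun h => by rw [h, o.sigMon_zero]⟩
  ext i a
  by_contra ha
  have hle := ModuleOrder.mon_le_sigMon (o := o) (mem_support_iff.2 ha)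
  exact WithBot.coe_ne_bot (le_bot_iff.1 (h ▸ hle))

lemma ModuleOrder.sig_of_sigMon_eq_mon {i : Fin m} {a : σ →₀ ℕ} (h : o.sigMon α = o.mon i a) :
    o.sig α = Pi.single i (monomial a ((α i).coeff a)) := by
  unfold ModuleOrder.sig
  rw [h]
  rfl

lemma ModuleOrder.sigMon_sub_le {T : WithBot o.Mon} (hα : o.sigMon α ≤ T) (hβ : o.sigMon β ≤ T) :
    o.sigMon (α - β) ≤ T := by
  classical
  refine ModuleOrder.sigMon_le_iff.2 fun i a ha => ?_
  rcases Finset.mem_union.1 (support_sub σ (α i) (β i) ha) with h | h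
  · exact (ModuleOrder.mon_le_sigMon h).trans hα
  · exact (ModuleOrder.mon_le_sigMon h).trans hβ

variable (o α) in
lemma ModuleOrder.sigMon_neg : o.sigMon (-α) = o.sigMon α := by
  simp [ModuleOrder.sigMon]

lemma ModuleOrder.sigMon_sub_of_lt (h : o.sigMon β < o.sigMon α) :
    o.sigMon (α - β) = o.sigMon α := by
  refine le_antisymm (ModuleOrder.sigMon_sub_le le_rfl h.le) ?_
  obtain ⟨i, a, ha, hs⟩ := ModuleOrder.exists_sigMon_eq_mon (ne_bot_of_gt h)
  have hβ : (β i).coeff a = 0 := by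
    by_contra hβ
    exact (ModuleOrder.mon_le_sigMon (mem_support_iff.2 hβ)).not_gt (hs ▸ h)
  rw [hs]
  refine ModuleOrder.mon_le_sigMon (mem_support_iff.2 ?_)
  rwa [Pi.sub_apply, coeff_sub, hβ, sub_zero, ← mem_support_iff]

variable (o α) in
lemma ModuleOrder.sigMon_monomial_smul (b : σ →₀ ℕ) {c : K} (hc : c ≠ 0) :
    o.sigMon (monomial b c • α) = b +ᵥ o.sigMon α := by
  refine le_antisymm (ModuleOrder.sigMon_le_iff.2 fun i a ha => ?_) ?_
  · rw [Pi.smul_apply, smul_eq_mul, mem_support_iff, coeff_monomial_mul', ite_ne_right_iff] at ha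
    obtain ⟨hba, ha⟩ := ha
    have h := (o.vadd_strictMono b).monotone
      (ModuleOrder.mon_le_sigMon (mem_support_iff.2 (right_ne_zero_of_mul ha)))
    simpa only [o.vadd_mon, add_tsub_cancel_of_le hba] using h
  · rcases eq_or_ne (o.sigMon α) ⊥ with h0 | h0
    · rw [h0, o.vadd_bot]
      exact bot_le
    obtain ⟨i, a, ha, hs⟩ := ModuleOrder.exists_sigMon_eq_mon h0
    rw [hs, o.vadd_mon]
    refine ModuleOrder.mon_le_sigMon (mem_support_iff.2 ?_)
    rw [Pi.smul_apply, smul_eq_mul, coeff_monomial_mul]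
    exact mul_ne_zero hc (mem_support_iff.1 ha)

variable (o α) in
lemma ModuleOrder.sigMon_smul {κ : K} (hκ : κ ≠ 0) : o.sigMon (κ • α) = o.sigMon α := by
  rw [← algebraMap_smul (MvPolynomial σ K) κ α, algebraMap_eq, C_apply,
    o.sigMon_monomial_smul α 0 hκ, zero_vadd]

lemma ModuleOrder.sigMon_single_monomial (i : Fin m) (a : σ →₀ ℕ) {c : K} (hc : c ≠ 0) :
    o.sigMon (Pi.single i (monomial a c) : FreeMod σ K m) = o.mon i a := by
  classical
  refine le_antisymm (ModuleOrder.sigMon_le_iff.2 fun j b hb => ?_)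
    (ModuleOrder.mon_le_sigMon (by simp [support_monomial, hc]))
  rcases eq_or_ne j i with rfl | hij
  · rw [Pi.single_eq_same, support_monomial, if_neg hc, Finset.mem_singleton] at hb
    rw [hb]
  · simp [Pi.single_eq_of_ne hij] at hb

lemma ModuleOrder.exists_vadd_sigMon_single_one (K : Type*) [Field K] {T : WithBot o.Mon}
    (hT : T ≠ ⊥) :
    ∃ (i : Fin m) (a : σ →₀ ℕ), a +ᵥ o.sigMon (Pi.single i 1 : FreeMod σ K m) = T := by
  obtain ⟨⟨i, a⟩, rfl⟩ := WithBot.ne_bot_iff_exists.1 hT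
  refine ⟨i, a, ?_⟩
  rw [one_def, ModuleOrder.sigMon_single_monomial i 0 one_ne_zero, o.vadd_mon, add_zero]
  rfl

variable (o α) in
lemma ModuleOrder.sig_smul {κ : K} (hκ : κ ≠ 0) : o.sig (κ • α) = κ • o.sig α := by
  rcases eq_or_ne (o.sigMon α) ⊥ with h0 | h0
  · rw [ModuleOrder.sigMon_eq_bot.1 h0, smul_zero]
    simp [ModuleOrder.sig, o.sigMon_zero]
  · obtain ⟨i, a, -, hs⟩ := ModuleOrder.exists_sigMon_eq_mon h0
    rw [ModuleOrder.sig_of_sigMon_eq_mon hs,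
      ModuleOrder.sig_of_sigMon_eq_mon ((o.sigMon_smul α hκ).trans hs), ← Pi.single_smul,
      smul_monomial, Pi.smul_apply, coeff_smul]

variable (o α) in
lemma ModuleOrder.sigMon_sig : o.sigMon (o.sig α) = o.sigMon α := by
  rcases eq_or_ne (o.sigMon α) ⊥ with h0 | h0
  · rw [ModuleOrder.sigMon_eq_bot.1 h0]
    simp [ModuleOrder.sig, o.sigMon_zero]
  · obtain ⟨i, a, ha, hs⟩ := ModuleOrder.exists_sigMon_eq_mon h0
    rw [ModuleOrder.sig_of_sigMon_eq_mon hs, hs,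
      ModuleOrder.sigMon_single_monomial i a (mem_support_iff.1 ha)]

lemma ModuleOrder.exists_sig_eq_sig_smul (h : o.sigMon α = o.sigMon β) :
    ∃ κ : K, κ ≠ 0 ∧ o.sig α = o.sig (κ • β) := by
  rcases eq_or_ne (o.sigMon α) ⊥ with h0 | h0
  · refine ⟨1, one_ne_zero, ?_⟩
    rw [ModuleOrder.sigMon_eq_bot.1 h0, ModuleOrder.sigMon_eq_bot.1 (h.symm.trans h0), one_smul]
  · obtain ⟨i, a, ha, hα⟩ := ModuleOrder.exists_sigMon_eq_mon h0
    obtain ⟨j, b, hb, hβ⟩ := ModuleOrder.exists_sigMon_eq_mon (h ▸ h0)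
    obtain ⟨rfl, rfl⟩ := Prod.mk.inj (WithBot.coe_injective ((hα.symm.trans h).trans hβ))
    have hb' := mem_support_iff.1 hb
    have hκ := div_ne_zero (mem_support_iff.1 ha) hb'
    refine ⟨(α i).coeff a / (β i).coeff a, hκ, ?_⟩
    rw [o.sig_smul β hκ, ModuleOrder.sig_of_sigMon_eq_mon hα, ModuleOrder.sig_of_sigMon_eq_mon hβ,
      ← Pi.single_smul, smul_monomial, smul_eq_mul, div_mul_cancel₀ _ hb']

lemma ModuleOrder.scalarEq_sig_iff :
    ScalarEq K (o.sig α) (o.sig β) ↔ o.sigMon α = o.sigMon β := by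
  refine ⟨fun ⟨κ, hκ, h⟩ => ?_, fun h => ?_⟩
  · rw [← o.sigMon_sig α, h, o.sigMon_smul _ hκ, o.sigMon_sig]
  · obtain ⟨κ, hκ, h⟩ := ModuleOrder.exists_sig_eq_sig_smul h
    exact ⟨κ, hκ, h.trans (o.sig_smul β hκ)⟩

lemma ModuleOrder.sigMon_sub_lt (h : o.sig α = o.sig β) (h0 : o.sigMon α ≠ ⊥) :
    o.sigMon (α - β) < o.sigMon α := by
  classical
  have hs : o.sigMon α = o.sigMon β := by rw [← o.sigMon_sig α, h, o.sigMon_sig]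
  refine (ModuleOrder.sigMon_sub_le le_rfl hs.ge).lt_of_ne fun heq => ?_
  obtain ⟨i, a, ha, hd⟩ := ModuleOrder.exists_sigMon_eq_mon (heq ▸ h0)
  have hα := heq.symm.trans hd
  rw [ModuleOrder.sig_of_sigMon_eq_mon hα, ModuleOrder.sig_of_sigMon_eq_mon (hs.symm.trans hα)] at h
  have hcoeff : (α i).coeff a = (β i).coeff a := by
    simpa [coeff_monomial] using congrArg (coeff a) (Pi.single_injective i h)
  exact mem_support_iff.1 ha (by rw [Pi.sub_apply, coeff_sub, hcoeff, sub_self])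

lemma ModuleOrder.exists_sigMon_sub_smul_lt (h : o.sigMon α = o.sigMon β) (h0 : o.sigMon α ≠ ⊥) :
    ∃ κ : K, κ ≠ 0 ∧ o.sig α = o.sig (κ • β) ∧ o.sigMon (α - κ • β) < o.sigMon α := by
  obtain ⟨κ, hκ, hsig⟩ := ModuleOrder.exists_sig_eq_sig_smul h
  exact ⟨κ, hκ, hsig, ModuleOrder.sigMon_sub_lt hsig h0⟩

end Signatures

section Projection

variable {σ K : Type*} [Field K] {m : ℕ} {ord : MonomialOrder σ} {o : ModuleOrder ord m}
  (f : Fin m → MvPolynomial σ K) (α β : FreeMod σ K m)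

lemma proj_eq_linearCombination : proj f = Fintype.linearCombination (MvPolynomial σ K) f :=
  rfl

lemma proj_zero : proj f 0 = 0 :=
  map_zero (Fintype.linearCombination (MvPolynomial σ K) f)

lemma proj_neg : proj f (-α) = -proj f α :=
  map_neg (Fintype.linearCombination (MvPolynomial σ K) f) α

lemma proj_sub : proj f (α - β) = proj f α - proj f β :=
  map_sub (Fintype.linearCombination (MvPolynomial σ K) f) α β

lemma proj_smul (p : MvPolynomial σ K) : proj f (p • α) = p * proj f α :=
  map_smul (Fintype.linearCombination (MvPolynomial σ K) f) p α

lemma proj_const_smul (κ : K) : proj f (κ • α) = κ • proj f α :=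
  (Fintype.linearCombination (MvPolynomial σ K) f).map_smul_of_tower κ α

lemma proj_eq_zero_of_mem_koszulSyzygies {h : FreeMod σ K m} (hh : h ∈ koszulSyzygies f) :
    proj f h = 0 := by
  obtain ⟨i, j, -, rfl⟩ := hh
  simp only [proj_eq_linearCombination, map_sub, Fintype.linearCombination_apply_single,
    smul_eq_mul, mul_comm, sub_self]

variable {f α}

lemma sigMon_ne_bot_of_proj_ne_zero (h : proj f α ≠ 0) : o.sigMon α ≠ ⊥ :=
  fun h0 => h (by rw [ModuleOrder.sigMon_eq_bot.1 h0, proj_zero])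

variable {b : σ →₀ ℕ} {c : K}

lemma proj_monomial_smul_ne_zero (hc : c ≠ 0) (h : proj f α ≠ 0) :
    proj f (monomial b c • α) ≠ 0 := by
  rw [proj_smul]
  exact mul_ne_zero (mt monomial_eq_zero.1 hc) h

lemma degree_proj_monomial_smul (hc : c ≠ 0) (h : proj f α ≠ 0) :
    ord.degree (proj f (monomial b c • α)) = b + ord.degree (proj f α) := by
  classical
  rw [proj_smul, ord.degree_mul (mt monomial_eq_zero.1 hc) h, ord.degree_monomial, if_neg hc]

lemma leadingTerm_proj_monomial_smul :
    ord.leadingTerm (proj f (monomial b c • α)) =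
      monomial (b + ord.degree (proj f α)) (c * ord.leadingCoeff (proj f α)) := by
  rw [proj_smul, ord.leadingTerm_mul, ord.leadingTerm_monomial, MonomialOrder.leadingTerm,
    monomial_mul]

end Projection

section Reduction

variable {σ K : Type*} [Field K] {m : ℕ} {ord : MonomialOrder σ}

/-- Some monomial multiple of `β` has lead monomial `x ^ d` and signature `T`. -/
def Covers (f : Fin m → MvPolynomial σ K) (o : ModuleOrder ord m) (β : FreeMod σ K m)
    (d : σ →₀ ℕ) (T : WithBot o.Mon) : Prop :=
  ∃ b, b + ord.degree (proj f β) = d ∧ b +ᵥ o.sigMon β = T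

/-- Some monomial multiple of an element of `G` has lead monomial `x ^ d` and signature `T`. -/
def IsCovered (f : Fin m → MvPolynomial σ K) (o : ModuleOrder ord m) (G : Set (FreeMod σ K m))
    (d : σ →₀ ℕ) (T : WithBot o.Mon) : Prop :=
  ∃ β ∈ G, Covers f o β d T

/-- The monomial `x ^ d`, occurring in the image of an element of signature `T`, can be eliminated
by a regular reduction step modulo `G`. -/
def IsRegularReducible (f : Fin m → MvPolynomial σ K) (o : ModuleOrder ord m)
    (G : Set (FreeMod σ K m)) (d : σ →₀ ℕ) (T : WithBot o.Mon) : Prop :=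
  ∃ S < T, IsCovered f o G d S

/-- `α` can be transformed into `γ` by regular reduction steps modulo `G`. -/
def Reduces (f : Fin m → MvPolynomial σ K) (o : ModuleOrder ord m) (G : Set (FreeMod σ K m)) :
    FreeMod σ K m → FreeMod σ K m → Prop :=
  Relation.ReflTransGen (RegularStep f o G)

variable {f : Fin m → MvPolynomial σ K} {o : ModuleOrder ord m} {G G' : Set (FreeMod σ K m)}
  {α α' β γ : FreeMod σ K m} {d : σ →₀ ℕ} {S T : WithBot o.Mon}

lemma Covers.vadd (x : σ →₀ ℕ) (h : Covers f o β d T) : Covers f o β (x + d) (x +ᵥ T) := by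
  obtain ⟨b, rfl, rfl⟩ := h
  exact ⟨x + b, add_assoc _ _ _, add_vadd _ _ _⟩

lemma Covers.self (β : FreeMod σ K m) : Covers f o β (ord.degree (proj f β)) (o.sigMon β) :=
  ⟨0, zero_add _, zero_vadd _ _⟩

lemma Covers.sigMon_le (h : Covers f o β d T) : o.sigMon β ≤ T := by
  obtain ⟨b, -, rfl⟩ := h
  exact o.le_vadd b _

lemma IsCovered.vadd (x : σ →₀ ℕ) (h : IsCovered f o G d T) :
    IsCovered f o G (x + d) (x +ᵥ T) :=
  h.imp fun _ hβ => ⟨hβ.1, hβ.2.vadd x⟩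

lemma IsCovered.mono (hG : G ⊆ G') (h : IsCovered f o G d T) : IsCovered f o G' d T :=
  h.imp fun _ hβ => ⟨hG hβ.1, hβ.2⟩

lemma IsCovered.exists_sigMon_eq (h : IsCovered f o G d T) (hG : ∀ β ∈ G, proj f β ≠ 0) :
    ∃ α, o.sigMon α = T ∧ proj f α ≠ 0 ∧ ord.degree (proj f α) = d := by
  obtain ⟨β, hβ, b, rfl, rfl⟩ := h
  exact ⟨monomial b 1 • β, o.sigMon_monomial_smul β b one_ne_zero,
    proj_monomial_smul_ne_zero one_ne_zero (hG β hβ),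
    degree_proj_monomial_smul one_ne_zero (hG β hβ)⟩

lemma exists_leadingTerm_eq (h0 : proj f β ≠ 0) (h : Covers f o β d T) {a : K} (ha : a ≠ 0) :
    ∃ bβ, IsMonomialMultiple β bβ ∧ proj f bβ ≠ 0 ∧ ord.leadingTerm (proj f bβ) = monomial d a ∧
      o.sigMon bβ = T := by
  obtain ⟨b, rfl, rfl⟩ := h
  have hlc := ord.leadingCoeff_ne_zero_iff.2 h0
  have hc := div_ne_zero ha hlc
  refine ⟨_, ⟨b, _, hc, rfl⟩, proj_monomial_smul_ne_zero hc h0, ?_,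
    o.sigMon_monomial_smul β b hc⟩
  rw [leadingTerm_proj_monomial_smul, div_mul_cancel₀ _ hlc]

lemma IsMonomialMultiple.covers {bβ : FreeMod σ K m} (h : IsMonomialMultiple β bβ)
    (h0 : proj f β ≠ 0) : Covers f o β (ord.degree (proj f bβ)) (o.sigMon bβ) := by
  obtain ⟨b, c, hc, rfl⟩ := h
  exact ⟨b, (degree_proj_monomial_smul hc h0).symm, (o.sigMon_monomial_smul β b hc).symm⟩

lemma IsRegularReducible.exists_regularStep (hG : ∀ β ∈ G, proj f β ≠ 0)
    (hd : d ∈ (proj f α).support) (h : IsRegularReducible f o G d (o.sigMon α)) :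
    ∃ δ, RegularStep f o G α δ := by
  obtain ⟨S, hS, β, hβ, hcov⟩ := h
  obtain ⟨bβ, hmul, h0, hlt, rfl⟩ := exists_leadingTerm_eq (hG β hβ) hcov (mem_support_iff.1 hd)
  exact ⟨_, β, hβ, bβ, hmul, ⟨_, ⟨d, hd, rfl⟩, h0, hlt, hS.le⟩,
    mt ModuleOrder.scalarEq_sig_iff.1 hS.ne, rfl⟩

lemma singularTopReducible_iff (hG : ∀ β ∈ G, proj f β ≠ 0) (hγ : proj f γ ≠ 0) :
    SingularTopReducible f o G γ ↔ IsCovered f o G (ord.degree (proj f γ)) (o.sigMon γ) := by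
  constructor
  · rintro ⟨β, hβ, bβ, hmul, -, ⟨κ, hκ, hlt⟩, hs⟩
    have hdeg : ord.degree (proj f bβ) = ord.degree (proj f γ) := by
      rw [← ord.degree_leadingTerm, hlt, ord.degree_smul_of_isRegular (.of_ne_zero hκ),
        ord.degree_leadingTerm]
    rw [← hdeg, ← ModuleOrder.scalarEq_sig_iff.1 hs]
    exact ⟨β, hβ, hmul.covers (hG β hβ)⟩
  · rintro ⟨β, hβ, hcov⟩
    obtain ⟨bβ, hmul, h0, hlt, hs⟩ :=
      exists_leadingTerm_eq (hG β hβ) hcov (ord.leadingCoeff_ne_zero_iff.2 hγ)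
    exact ⟨β, hβ, bβ, hmul, ⟨_, ⟨_, ord.degree_mem_support hγ, rfl⟩, h0, hlt, hs.le⟩,
      ⟨1, one_ne_zero, hlt.trans (one_smul K _).symm⟩, ModuleOrder.scalarEq_sig_iff.2 hs⟩

lemma RegularStep.mono (hG : G ⊆ G') (h : RegularStep f o G α α') : RegularStep f o G' α α' :=
  h.imp fun _ hβ => ⟨hG hβ.1, hβ.2⟩

lemma RegularStep.sigMon_eq (h : RegularStep f o G α α') : o.sigMon α' = o.sigMon α := by
  obtain ⟨β, -, bβ, -, ⟨t, -, -, -, hle⟩, hne, rfl⟩ := h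
  exact ModuleOrder.sigMon_sub_of_lt (hle.lt_of_ne (mt ModuleOrder.scalarEq_sig_iff.2 hne))

lemma RegularStep.proj_ne_zero (h : RegularStep f o G α α') : proj f α ≠ 0 := by
  obtain ⟨β, -, bβ, -, ⟨t, ⟨d, hd, -⟩, -⟩, -⟩ := h
  exact ne_zero_iff.2 ⟨d, mem_support_iff.1 hd⟩

lemma RegularStep.degree_le (h : RegularStep f o G α α') :
    ord.degree (proj f α') ≼[ord] ord.degree (proj f α) := by
  classical
  obtain ⟨β, -, bβ, -, ⟨t, ⟨d, hd, rfl⟩, -, ht, -⟩, -, rfl⟩ := h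
  have hdeg : ord.degree (proj f bβ) = d := by
    rw [← ord.degree_leadingTerm, ht, ord.degree_monomial, if_neg (mem_support_iff.1 hd)]
  rw [proj_sub]
  exact ord.degree_sub_le.trans (sup_le le_rfl (hdeg ▸ ord.le_degree hd))

lemma Reduces.mono (hG : G ⊆ G') (h : Reduces f o G α γ) : Reduces f o G' α γ :=
  Relation.ReflTransGen.mono (fun _ _ => RegularStep.mono hG) _ _ h

lemma Reduces.sigMon_eq (h : Reduces f o G α γ) : o.sigMon γ = o.sigMon α := by
  induction h with
  | refl => rfl
  | tail _ h ih => exact h.sigMon_eq.trans ih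

lemma Reduces.proj_ne_zero (h : Reduces f o G α γ) (hγ : proj f γ ≠ 0) : proj f α ≠ 0 := by
  induction h using Relation.ReflTransGen.head_induction_on with
  | refl => exact hγ
  | head h _ _ => exact h.proj_ne_zero

lemma Reduces.degree_le (h : Reduces f o G α γ) :
    ord.degree (proj f γ) ≼[ord] ord.degree (proj f α) := by
  induction h with
  | refl => exact le_rfl
  | tail _ h ih => exact h.degree_le.trans ih

end Reduction

section SPairs

variable {σ K : Type*} [Field K] {m : ℕ} {ord : MonomialOrder σ}
  {f : Fin m → MvPolynomial σ K} {o : ModuleOrder ord m} {α β : FreeMod σ K m}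

lemma regularPair_iff : RegularPair f o α β ↔
    o.sigMon (leg f ord α β) ≠ o.sigMon (leg f ord β α) :=
  ModuleOrder.scalarEq_sig_iff.not

lemma RegularPair.symm (h : RegularPair f o α β) : RegularPair f o β α :=
  regularPair_iff.2 (regularPair_iff.1 h).symm

lemma not_regularPair_self : ¬ RegularPair f o α α :=
  fun h => regularPair_iff.1 h rfl

lemma neg_sPair (α β : FreeMod σ K m) : -sPair f ord α β = sPair f ord β α :=
  neg_sub _ _

lemma isMonomialMultiple_leg (hα : proj f α ≠ 0) (β : FreeMod σ K m) :
    IsMonomialMultiple α (leg f ord α β) :=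
  ⟨_, _, inv_ne_zero (ord.leadingCoeff_ne_zero_iff.2 hα), rfl⟩

lemma sigMon_leg (hα : proj f α ≠ 0) (β : FreeMod σ K m) :
    o.sigMon (leg f ord α β) =
      (ord.degree (proj f α) ⊔ ord.degree (proj f β) - ord.degree (proj f α)) +ᵥ o.sigMon α :=
  o.sigMon_monomial_smul α _ (inv_ne_zero (ord.leadingCoeff_ne_zero_iff.2 hα))

lemma sigMon_le_sigMon_leg (hα : proj f α ≠ 0) (β : FreeMod σ K m) :
    o.sigMon α ≤ o.sigMon (leg f ord α β) :=
  (o.le_vadd _ _).trans_eq (sigMon_leg hα β).symm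

lemma sigMon_sPair (h : RegularPair f o α β) :
    o.sigMon (sPair f ord α β) = o.sigMon (leg f ord α β) ⊔ o.sigMon (leg f ord β α) := by
  rcases lt_or_gt_of_ne (regularPair_iff.1 h) with hlt | hlt
  · rw [sup_eq_right.2 hlt.le, ← neg_sPair, o.sigMon_neg, sPair, ModuleOrder.sigMon_sub_of_lt hlt]
  · rw [sup_eq_left.2 hlt.le, sPair, ModuleOrder.sigMon_sub_of_lt hlt]

lemma proj_sPair (hα : proj f α ≠ 0) (hβ : proj f β ≠ 0) :
    proj f (sPair f ord α β) =
      (ord.leadingCoeff (proj f α) * ord.leadingCoeff (proj f β))⁻¹ •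
        ord.sPolynomial (proj f α) (proj f β) := by
  have hα' := ord.leadingCoeff_ne_zero_iff.2 hα
  have hβ' := ord.leadingCoeff_ne_zero_iff.2 hβ
  rw [ord.sPolynomial_def, smul_sub, ← smul_mul_assoc, ← smul_mul_assoc, smul_monomial,
    smul_monomial, sPair, proj_sub, leg, leg, proj_smul, proj_smul, cofactor, cofactor,
    sup_comm (ord.degree (proj f β))]
  congr 3 <;> rw [smul_eq_mul] <;> field_simp

lemma degree_sPair_lt (hα : proj f α ≠ 0) (hβ : proj f β ≠ 0) (h : proj f (sPair f ord α β) ≠ 0) :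
    ord.degree (proj f (sPair f ord α β)) ≺[ord]
      ord.degree (proj f α) ⊔ ord.degree (proj f β) := by
  rw [proj_sPair hα hβ] at h ⊢
  have hlc := mul_ne_zero (ord.leadingCoeff_ne_zero_iff.2 hα) (ord.leadingCoeff_ne_zero_iff.2 hβ)
  rw [ord.degree_smul_of_isRegular (.of_ne_zero (inv_ne_zero hlc))]
  exact ord.degree_sPolynomial_lt_sup_degree (right_ne_zero_of_smul h)

lemma Covers.vadd_sigMon_leg {d : σ →₀ ℕ} {T : WithBot o.Mon} (h : Covers f o α d T)
    (hα : proj f α ≠ 0) (hd : ord.degree (proj f α) ⊔ ord.degree (proj f β) ≤ d) :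
    (d - ord.degree (proj f α) ⊔ ord.degree (proj f β)) +ᵥ o.sigMon (leg f ord α β) = T := by
  obtain ⟨b, rfl, rfl⟩ := h
  rw [sigMon_leg hα, ← add_vadd, tsub_add_tsub_cancel hd le_sup_left, add_tsub_cancel_right]

lemma Covers.exists_vadd_sigMon_leg {d : σ →₀ ℕ} {T U : WithBot o.Mon} (hT : Covers f o α d T)
    (hU : Covers f o β d U) (hα : proj f α ≠ 0) (hβ : proj f β ≠ 0) :
    ∃ x, x + (ord.degree (proj f α) ⊔ ord.degree (proj f β)) = d ∧
      x +ᵥ o.sigMon (leg f ord α β) = T ∧ x +ᵥ o.sigMon (leg f ord β α) = U := by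
  have hle : ord.degree (proj f α) ⊔ ord.degree (proj f β) ≤ d := by
    obtain ⟨b, rfl, -⟩ := hT
    obtain ⟨c, hc, -⟩ := hU
    exact sup_le le_add_self (hc ▸ le_add_self)
  refine ⟨_, tsub_add_cancel_of_le hle, hT.vadd_sigMon_leg hα hle, ?_⟩
  rw [sup_comm] at hle ⊢
  exact hU.vadd_sigMon_leg hβ hle

end SPairs

section SignatureBases

variable {σ K : Type*} [Field K] {m : ℕ} {ord : MonomialOrder σ}

/-- `G` is a signature Gröbner basis in signature `T`: every element of signature `T` that is not a
syzygy is top reducible modulo `G`, regularly or singularly. -/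
def IsSigBasisAt (f : Fin m → MvPolynomial σ K) (o : ModuleOrder ord m) (G : Set (FreeMod σ K m))
    (T : WithBot o.Mon) : Prop :=
  ∀ α, o.sigMon α = T → proj f α ≠ 0 → ∃ S ≤ T, IsCovered f o G (ord.degree (proj f α)) S

/-- The signature `T` is divisible by the signature of an element of `H`. -/
def SigDivisible (o : ModuleOrder ord m) (H : Set (FreeMod σ K m)) (T : WithBot o.Mon) : Prop :=
  ∃ h ∈ H, ∃ b : σ →₀ ℕ, b +ᵥ o.sigMon h = T

/-- `C` selects for each signature `T` that is not divisible by the signature of an element of `H`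
the lead monomials `x ^ d` of preferred multiples of elements of `G`, in such a way that each lead
monomial is selected in at most one signature. Both algorithms maintain such a selection, and it
forces the output to be a signature Gröbner basis. -/
structure IsCanonicalCover (f : Fin m → MvPolynomial σ K) (o : ModuleOrder ord m)
    (G H : Set (FreeMod σ K m)) (C : (σ →₀ ℕ) → WithBot o.Mon → Prop) : Prop where
  isCovered : ∀ {d T}, C d T → IsCovered f o G d T
  exists_of_not_sigDivisible : ∀ {T}, T ≠ ⊥ → ¬ SigDivisible o H T → ∃ d, C d T
  injective : ∀ {d T U}, C d T → C d U → T = U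

variable {f : Fin m → MvPolynomial σ K} {o : ModuleOrder ord m} {G H H' : Set (FreeMod σ K m)}
  {α β : FreeMod σ K m} {d : σ →₀ ℕ} {T : WithBot o.Mon}
  {C : (σ →₀ ℕ) → WithBot o.Mon → Prop}

lemma SigDivisible.mono (hH : H ⊆ H') (h : SigDivisible o H T) : SigDivisible o H' T :=
  h.imp fun _ hh => ⟨hH hh.1, hh.2⟩

lemma SigDivisible.vadd (x : σ →₀ ℕ) (h : SigDivisible o H T) : SigDivisible o H (x +ᵥ T) := by
  obtain ⟨η, hη, b, rfl⟩ := h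
  exact ⟨η, hη, x + b, add_vadd _ _ _⟩

lemma isRegularReducible_of_sigMon_lt (hT : ∀ S < T, IsSigBasisAt f o G S) (hα : o.sigMon α < T)
    (h0 : proj f α ≠ 0) : IsRegularReducible f o G (ord.degree (proj f α)) T := by
  obtain ⟨S, hS, hcov⟩ := hT _ hα α rfl h0
  exact ⟨S, hS.trans_lt hα, hcov⟩

lemma SigDivisible.isRegularReducible (h : SigDivisible o H (o.sigMon α))
    (hH : ∀ η ∈ H, proj f η = 0) (hT : ∀ S < o.sigMon α, IsSigBasisAt f o G S)
    (h0 : proj f α ≠ 0) : IsRegularReducible f o G (ord.degree (proj f α)) (o.sigMon α) := by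
  obtain ⟨η, hη, b, hb⟩ := h
  obtain ⟨κ, -, -, hlt⟩ := ModuleOrder.exists_sigMon_sub_smul_lt
    (hb.symm.trans (o.sigMon_monomial_smul η b (one_ne_zero (α := K))).symm)
    (sigMon_ne_bot_of_proj_ne_zero h0)
  have hproj : proj f (α - κ • (monomial b 1 : MvPolynomial σ K) • η) = proj f α := by
    rw [proj_sub, proj_const_smul, proj_smul, hH η hη, mul_zero, smul_zero, sub_zero]
  rw [← hproj] at h0 ⊢
  exact isRegularReducible_of_sigMon_lt hT hlt h0

lemma degree_eq_of_not_isRegularReducible (hT : ∀ S < T, IsSigBasisAt f o G S)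
    (hα : o.sigMon α = T) (hβ : o.sigMon β = T) (hα0 : proj f α ≠ 0)
    (hαr : ¬ IsRegularReducible f o G (ord.degree (proj f α)) T)
    (hβr : ¬ IsRegularReducible f o G (ord.degree (proj f β)) T) :
    ord.degree (proj f α) = ord.degree (proj f β) := by
  obtain ⟨κ, hκ, -, hlt⟩ := ModuleOrder.exists_sigMon_sub_smul_lt (hα.trans hβ.symm)
    (sigMon_ne_bot_of_proj_ne_zero hα0)
  rw [hα] at hlt
  have hdeg : ord.degree (proj f (κ • β)) = ord.degree (proj f β) := by
    rw [proj_const_smul, ord.degree_smul_of_isRegular (.of_ne_zero hκ)]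
  rw [← hdeg] at hβr ⊢
  by_contra hne
  have h0 : proj f (α - κ • β) ≠ 0 := fun h =>
    hne (congrArg ord.degree (sub_eq_zero.1 ((proj_sub f _ _).symm.trans h)))
  have hred := isRegularReducible_of_sigMon_lt hT hlt h0
  rcases lt_or_gt_of_ne (ord.toSyn.injective.ne hne) with hlt' | hlt'
  · rw [proj_sub, ← neg_sub, ord.degree_neg, ord.degree_sub_of_lt hlt'] at hred
    exact hβr hred
  · rw [proj_sub, ord.degree_sub_of_lt hlt'] at hred
    exact hαr hred

lemma IsCovered.degree_eq (h : IsCovered f o G d T) (hG : ∀ β ∈ G, proj f β ≠ 0)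
    (hT : ∀ S < T, IsSigBasisAt f o G S) (hd : ¬ IsRegularReducible f o G d T)
    (hα : o.sigMon α = T)
    (hαr : ¬ IsRegularReducible f o G (ord.degree (proj f α)) T) :
    ord.degree (proj f α) = d := by
  obtain ⟨β, hβ, hβ0, rfl⟩ := h.exists_sigMon_eq hG
  exact (degree_eq_of_not_isRegularReducible hT hβ hα hβ0 hd hαr).symm

namespace IsCanonicalCover

/-- If the lead monomial were covered in a smaller signature, take the least such signature `U`:
there it is not regular reducible, hence selected, against injectivity of the selection. -/
lemma not_isRegularReducible (hC : IsCanonicalCover f o G H C) (hG : ∀ β ∈ G, proj f β ≠ 0)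
    (hH : ∀ η ∈ H, proj f η = 0) (hT : ∀ S < T, IsSigBasisAt f o G S)
    (ih : ∀ U < T, ∀ e, C e U → ¬ IsRegularReducible f o G e U) (hd : C d T) :
    ¬ IsRegularReducible f o G d T := by
  intro hred
  obtain ⟨U, ⟨hUT, hU⟩, hmin⟩ := wellFounded_lt.has_min {U | U < T ∧ IsCovered f o G d U} hred
  have hdU : ¬ IsRegularReducible f o G d U := fun ⟨S, hSU, hS⟩ => hmin S ⟨hSU.trans hUT, hS⟩ hSU
  have hbasis : ∀ S < U, IsSigBasisAt f o G S := fun S hS => hT S (hS.trans hUT)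
  obtain ⟨α, rfl, hα0, rfl⟩ := hU.exists_sigMon_eq hG
  obtain ⟨e, he⟩ := hC.exists_of_not_sigDivisible (sigMon_ne_bot_of_proj_ne_zero hα0)
    fun hdiv => hdU (hdiv.isRegularReducible hH hbasis hα0)
  obtain rfl := (hC.isCovered he).degree_eq hG hbasis (ih _ hUT e he) rfl hdU
  exact hUT.ne (hC.injective he hd)

lemma isSigBasisAt_of_forall_lt (hC : IsCanonicalCover f o G H C)
    (hG : ∀ β ∈ G, proj f β ≠ 0) (hH : ∀ η ∈ H, proj f η = 0)
    (hT : ∀ S < T, IsSigBasisAt f o G S)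
    (hCT : ∀ d, C d T → ¬ IsRegularReducible f o G d T) : IsSigBasisAt f o G T := by
  rintro α rfl hα0
  by_cases hαr : IsRegularReducible f o G (ord.degree (proj f α)) (o.sigMon α)
  · exact hαr.imp fun _ h => ⟨h.1.le, h.2⟩
  obtain ⟨d, hd⟩ := hC.exists_of_not_sigDivisible (sigMon_ne_bot_of_proj_ne_zero hα0)
    fun hdiv => hαr (hdiv.isRegularReducible hH hT hα0)
  rw [(hC.isCovered hd).degree_eq hG hT (hCT d hd) rfl hαr]
  exact ⟨_, le_rfl, hC.isCovered hd⟩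

theorem isSigBasisAt (hC : IsCanonicalCover f o G H C) (hG : ∀ β ∈ G, proj f β ≠ 0)
    (hH : ∀ η ∈ H, proj f η = 0) (T : WithBot o.Mon) : IsSigBasisAt f o G T := by
  suffices IsSigBasisAt f o G T ∧ ∀ d, C d T → ¬ IsRegularReducible f o G d T from this.1
  induction T using WellFoundedLT.induction with
  | ind T ih =>
    have hT : ∀ S < T, IsSigBasisAt f o G S := fun S hS => (ih S hS).1
    have hCT : ∀ d, C d T → ¬ IsRegularReducible f o G d T := fun d hd =>
      hC.not_isRegularReducible hG hH hT (fun U hU => (ih U hU).2) hd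
    exact ⟨hC.isSigBasisAt_of_forall_lt hG hH hT hCT, hCT⟩

end IsCanonicalCover

/-- Two irreducible elements of equal signature have equal images up to a scalar: otherwise the lead
monomial of a suitable difference, which has smaller signature, is reducible in one of them. -/
lemma eqUpToSigPoly_of_irreducible {G' : Set (FreeMod σ K m)} (hG : ∀ T, IsSigBasisAt f o G T)
    (hG' : ∀ T, IsSigBasisAt f o G' T) (hs : o.sigMon α = o.sigMon β) (h0 : o.sigMon α ≠ ⊥)
    (hα : ∀ d ∈ (proj f α).support, ¬ IsRegularReducible f o G d (o.sigMon α))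
    (hβ : ∀ d ∈ (proj f β).support, ¬ IsRegularReducible f o G' d (o.sigMon β)) :
    EqUpToSigPoly f o α β := by
  classical
  obtain ⟨κ, hκ, hsig, hlt⟩ := ModuleOrder.exists_sigMon_sub_smul_lt hs h0
  refine ⟨κ, hκ, hsig, ?_⟩
  by_contra hne
  have hne' : proj f (α - κ • β) ≠ 0 := by rwa [proj_sub, sub_ne_zero]
  have hd := ord.degree_mem_support hne'
  rw [proj_sub] at hd
  rcases Finset.mem_union.1 (support_sub σ _ _ hd) with hd | hd <;> rw [← proj_sub] at hd
  · exact hα _ hd (isRegularReducible_of_sigMon_lt (fun S _ => hG S) hlt hne')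
  · rw [proj_const_smul] at hd
    exact hβ _ (support_smul hd) (isRegularReducible_of_sigMon_lt (fun S _ => hG' S)
      (hlt.trans_eq hs) hne')

end SignatureBases

section Invariants

variable {σ K : Type*} [Field K] {m : ℕ} {ord : MonomialOrder σ}

/-- Properties of the program variables that persist in both algorithms. The two algorithms differ
in `D`, where `D (G, H)` is the set of entries of the pair set that count as dealt with once the
basis is `G` and the syzygies are `H`. -/
structure Invariant (f : Fin m → MvPolynomial σ K) (o : ModuleOrder ord m)
    (D : Set (FreeMod σ K m) × Set (FreeMod σ K m) → Set (Pair σ K m)) (s : State σ K m) :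
    Prop where
  finite : s.G.Finite
  proj_ne_zero : ∀ β ∈ s.G, proj f β ≠ 0
  proj_eq_zero : ∀ η ∈ s.H, proj f η = 0
  irreducible : ∀ β ∈ s.G, ∀ d ∈ (proj f β).support, ¬ IsRegularReducible f o s.G d (o.sigMon β)
  sigMon_le : ∀ β ∈ s.G, ∀ p ∈ s.P, o.sigMon β ≤ o.sigMon (p.val f ord)
  generators : ∀ α β, .spair α β ∈ s.P → α ∈ s.G ∧ β ∈ s.G
  unit : ∀ i, .unit i ∈ s.P ∪ D (s.G, s.H)
  pair : ∀ α ∈ s.G, ∀ β ∈ s.G, RegularPair f o α β →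
    .spair α β ∈ s.P ∪ D (s.G, s.H) ∨ .spair β α ∈ s.P ∪ D (s.G, s.H)

variable {f : Fin m → MvPolynomial σ K} {o : ModuleOrder ord m}
  {D : Set (FreeMod σ K m) × Set (FreeMod σ K m) → Set (Pair σ K m)} {s : State σ K m}
  {G G' H H' : Set (FreeMod σ K m)} {α β γ : FreeMod σ K m} {p : Pair σ K m}

lemma union_subset_sdiff_singleton_union {P : Set (Pair σ K m)} (hD : Monotone D) (hG : G ⊆ G')
    (hH : H ⊆ H') (hp : p ∈ D (G', H')) : P ∪ D (G, H) ⊆ P \ {p} ∪ D (G', H') := by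
  rintro q (hq | hq)
  · by_cases hqp : q = p
    · exact .inr (hqp ▸ hp)
    · exact .inl ⟨hq, hqp⟩
  · exact .inr (hD (Prod.mk_le_mk.2 ⟨hG, hH⟩) hq)

lemma isRegularReducible_union_singleton_iff {d : σ →₀ ℕ} {T : WithBot o.Mon}
    (hT : T ≤ o.sigMon γ) :
    IsRegularReducible f o (G ∪ {γ}) d T ↔ IsRegularReducible f o G d T := by
  refine ⟨?_, fun ⟨S, hS, h⟩ => ⟨S, hS, h.mono Set.subset_union_left⟩⟩
  rintro ⟨S, hS, δ, hδ | rfl, hcov⟩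
  · exact ⟨S, hS, δ, hδ, hcov⟩
  · exact absurd (hT.trans hcov.sigMon_le) hS.not_ge

lemma sigMon_le_of_mem_newPairs (hγ : proj f γ ≠ 0) (hp : p ∈ newPairs f o G γ) :
    o.sigMon γ ≤ o.sigMon (p.val f ord) := by
  obtain ⟨α, -, hreg, rfl⟩ := hp
  exact (sigMon_le_sigMon_leg hγ α).trans (le_sup_right.trans (sigMon_sPair hreg).ge)

namespace Invariant

lemma start (D : Set (FreeMod σ K m) × Set (FreeMod σ K m) → Set (Pair σ K m))
    (hH : ∀ η ∈ H, proj f η = 0) : Invariant f o D ⟨∅, H, Set.range Pair.unit⟩ where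
  finite := Set.finite_empty
  proj_ne_zero _ h := h.elim
  proj_eq_zero := hH
  irreducible _ h := h.elim
  sigMon_le _ h := h.elim
  generators _ _ h := by simp at h
  unit i := .inl ⟨i, rfl⟩
  pair _ h := h.elim

lemma unit_mem (hs : Invariant f o D ⟨G, H, ∅⟩) (i : Fin m) : .unit i ∈ D (G, H) :=
  (hs.unit i).resolve_left (Set.notMem_empty _)

lemma pair_mem (hs : Invariant f o D ⟨G, H, ∅⟩) (hα : α ∈ G) (hβ : β ∈ G)
    (h : RegularPair f o α β) : .spair α β ∈ D (G, H) ∨ .spair β α ∈ D (G, H) := by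
  simpa only [Set.empty_union] using hs.pair α hα β hβ h

lemma discard (hD : Monotone D) (hs : Invariant f o D s) (hH : s.H ⊆ H)
    (hsyz : ∀ η ∈ H, proj f η = 0) (hp : p ∈ D (s.G, H)) :
    Invariant f o D ⟨s.G, H, s.P \ {p}⟩ where
  finite := hs.finite
  proj_ne_zero := hs.proj_ne_zero
  proj_eq_zero := hsyz
  irreducible := hs.irreducible
  sigMon_le β hβ q hq := hs.sigMon_le β hβ q hq.1
  generators α β hq := hs.generators α β hq.1
  unit i := union_subset_sdiff_singleton_union hD subset_rfl hH hp (hs.unit i)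
  pair α hα β hβ h := by
    have hsub := union_subset_sdiff_singleton_union (P := s.P) hD subset_rfl hH hp
    exact (hs.pair α hα β hβ h).imp (@hsub _) (@hsub _)

lemma addSyzygy (hD : Monotone D) (hs : Invariant f o D s) (h0 : proj f γ = 0)
    (hp : p ∈ D (s.G, s.H ∪ {γ})) : Invariant f o D ⟨s.G, s.H ∪ {γ}, s.P \ {p}⟩ := by
  refine hs.discard hD Set.subset_union_left ?_ hp
  rintro η (hη | rfl)
  · exact hs.proj_eq_zero η hη
  · exact h0

lemma sigMon_le_reduct (hs : Invariant f o D s) (hp : IsNext f o s.P p)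
    (hγ : IsRegularReduction f o s.G (p.val f ord) γ) (hβ : β ∈ s.G ∪ {γ}) :
    o.sigMon β ≤ o.sigMon γ := by
  rcases hβ with hβ | rfl
  · exact (hs.sigMon_le β hβ p hp.1).trans (Reduces.sigMon_eq hγ.1).ge
  · exact le_rfl

lemma addBasis (hD : Monotone D) (hs : Invariant f o D s) (hp : IsNext f o s.P p)
    (hγ : IsRegularReduction f o s.G (p.val f ord) γ) (h0 : proj f γ ≠ 0)
    (hpD : p ∈ D (s.G ∪ {γ}, s.H)) :
    Invariant f o D ⟨s.G ∪ {γ}, s.H, s.P \ {p} ∪ newPairs f o s.G γ⟩ := by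
  have hle : ∀ β ∈ s.G ∪ {γ}, o.sigMon β ≤ o.sigMon γ := fun β => hs.sigMon_le_reduct hp hγ
  have hsub : s.P ∪ D (s.G, s.H) ⊆ s.P \ {p} ∪ newPairs f o s.G γ ∪ D (s.G ∪ {γ}, s.H) :=
    (union_subset_sdiff_singleton_union hD Set.subset_union_left subset_rfl hpD).trans
      (Set.union_subset_union_left _ Set.subset_union_left)
  refine ⟨hs.finite.union (Set.finite_singleton γ), ?_, hs.proj_eq_zero, ?_, ?_, ?_,
    fun i => hsub (hs.unit i), ?_⟩
  · rintro β (hβ | rfl)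
    exacts [hs.proj_ne_zero β hβ, h0]
  · intro β hβ d hd hred
    rw [isRegularReducible_union_singleton_iff (hle β hβ)] at hred
    rcases hβ with hβ | rfl
    · exact hs.irreducible β hβ d hd hred
    · obtain ⟨δ, hδ⟩ := hred.exists_regularStep hs.proj_ne_zero hd
      exact hγ.2 δ hδ
  · rintro β hβ q (hq | hq)
    · exact (hle β hβ).trans ((Reduces.sigMon_eq hγ.1).le.trans (hp.2 q hq.1))
    · exact (hle β hβ).trans (sigMon_le_of_mem_newPairs h0 hq)
  · rintro α β (hq | ⟨δ, hδ, -, ⟨⟩⟩)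
    · exact (hs.generators α β hq.1).imp .inl .inl
    · exact ⟨.inl hδ, .inr rfl⟩
  · rintro α (hα | rfl) β (hβ | rfl) hreg
    · exact (hs.pair α hα β hβ hreg).imp (@hsub _) (@hsub _)
    · exact .inl (.inl (.inr ⟨α, hα, hreg, rfl⟩))
    · exact .inr (.inl (.inr ⟨β, hβ, hreg.symm, rfl⟩))
    · exact absurd hreg not_regularPair_self

end Invariant

end Invariants

section GenSB

variable {σ K : Type*} [Field K] {m : ℕ} {ord : MonomialOrder σ}

/-- `α` needs no further treatment in `genSB`: either its signature is divisible by that of a known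
syzygy, or some multiple of an element of `G` has the signature of `α` and no larger lead
monomial. -/
def Settled (f : Fin m → MvPolynomial σ K) (o : ModuleOrder ord m) (G H : Set (FreeMod σ K m))
    (α : FreeMod σ K m) : Prop :=
  SigDivisible o H (o.sigMon α) ∨
    proj f α ≠ 0 ∧ ∃ d, d ≼[ord] ord.degree (proj f α) ∧ IsCovered f o G d (o.sigMon α)

/-- The entries of the pair set that stand for settled elements. -/
def settledPairs (f : Fin m → MvPolynomial σ K) (o : ModuleOrder ord m)
    (s : Set (FreeMod σ K m) × Set (FreeMod σ K m)) : Set (Pair σ K m) :=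
  {p | Settled f o s.1 s.2 (p.val f ord)}

/-- No element of `G` is singular top reducible by an element of `G` of smaller signature. -/
def IsSingularReduced (f : Fin m → MvPolynomial σ K) (o : ModuleOrder ord m)
    (G : Set (FreeMod σ K m)) : Prop :=
  ∀ γ ∈ G, ∀ δ ∈ G, Covers f o δ (ord.degree (proj f γ)) (o.sigMon γ) → o.sigMon δ = o.sigMon γ

/-- `x ^ d` is the least lead monomial of a multiple of an element of `G` in signature `T`, which is
not the signature of a known syzygy. -/
def IsLeastCovered (f : Fin m → MvPolynomial σ K) (o : ModuleOrder ord m)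
    (G H : Set (FreeMod σ K m)) (d : σ →₀ ℕ) (T : WithBot o.Mon) : Prop :=
  ¬ SigDivisible o H T ∧ IsCovered f o G d T ∧ ∀ e, IsCovered f o G e T → d ≼[ord] e

variable {f : Fin m → MvPolynomial σ K} {o : ModuleOrder ord m} {s s' : State σ K m}
  {G H : Set (FreeMod σ K m)} {α β γ : FreeMod σ K m} {d : σ →₀ ℕ} {T U : WithBot o.Mon}

lemma Settled.of_reduces (h : Reduces f o G α γ) (hγ : proj f γ ≠ 0)
    (hcov : IsCovered f o G (ord.degree (proj f γ)) (o.sigMon γ)) : Settled f o G H α :=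
  .inr ⟨h.proj_ne_zero hγ, _, h.degree_le, h.sigMon_eq ▸ hcov⟩

lemma Settled.neg (h : Settled f o G H α) : Settled f o G H (-α) := by
  rwa [Settled, o.sigMon_neg, proj_neg, neg_ne_zero, ord.degree_neg]

lemma monotone_settledPairs : Monotone (settledPairs f o) := fun _ _ hxy _ hp =>
  hp.imp (.mono hxy.2) fun ⟨h0, d, hd, hcov⟩ => ⟨h0, d, hd, hcov.mono hxy.1⟩

lemma GenSBStep.invariant (h : GenSBStep f o s s') (hs : Invariant f o (settledPairs f o) s) :
    Invariant f o (settledPairs f o) s' := by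
  cases h with
  | syzygy p γ _ hγ h0 =>
    exact hs.addSyzygy monotone_settledPairs h0
      (.inl ⟨γ, .inr rfl, 0, (zero_vadd _ _).trans (Reduces.sigMon_eq hγ.1)⟩)
  | basis p γ hp hγ h0 _ =>
    exact hs.addBasis monotone_settledPairs hp hγ h0
      (.of_reduces (Reduces.mono Set.subset_union_left hγ.1) h0 ⟨γ, .inr rfl, .self γ⟩)
  | singular p γ _ hγ h0 hsing =>
    exact hs.discard monotone_settledPairs subset_rfl hs.proj_eq_zero
      (.of_reduces hγ.1 h0 ((singularTopReducible_iff hs.proj_ne_zero h0).1 hsing))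

lemma GenSBStep.isSingularReduced (h : GenSBStep f o s s')
    (hs : Invariant f o (settledPairs f o) s) (hG : IsSingularReduced f o s.G) :
    IsSingularReduced f o s'.G := by
  cases h with
  | syzygy => exact hG
  | singular => exact hG
  | basis p γ hp hγ h0 hsing =>
    rintro η hη δ (hδ | rfl) hcov
    · rcases hη with hη | rfl
      · exact hG η hη δ hδ hcov
      · exact absurd ((singularTopReducible_iff hs.proj_ne_zero h0).2 ⟨δ, hδ, hcov⟩) hsing
    · exact hcov.sigMon_le.antisymm (hs.sigMon_le_reduct hp hγ hη)

theorem GenSBReturns.invariant (h : GenSBReturns f o G H) :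
    Invariant f o (settledPairs f o) ⟨G, H, ∅⟩ ∧ IsSingularReduced f o G := by
  suffices ∀ s, Relation.ReflTransGen (GenSBStep f o) ⟨∅, ∅, Set.range Pair.unit⟩ s →
      Invariant f o (settledPairs f o) s ∧ IsSingularReduced f o s.G from this _ h
  intro s hs
  induction hs with
  | refl => exact ⟨.start _ fun _ h => h.elim, fun _ h => h.elim⟩
  | tail _ h ih => exact ⟨h.invariant ih.1, h.isSingularReduced ih.1 ih.2⟩

lemma Invariant.settled_sPair (hs : Invariant f o (settledPairs f o) ⟨G, H, ∅⟩) (hα : α ∈ G)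
    (hβ : β ∈ G) (h : RegularPair f o α β) : Settled f o G H (sPair f ord α β) := by
  rcases hs.pair_mem hα hβ h with h | h
  · exact h
  · exact neg_sPair (f := f) (ord := ord) β α ▸ Settled.neg h

lemma Invariant.exists_isLeastCovered (hs : Invariant f o (settledPairs f o) ⟨G, H, ∅⟩)
    (hT : T ≠ ⊥) (hTH : ¬ SigDivisible o H T) : ∃ d, IsLeastCovered f o G H d T := by
  obtain ⟨i, a, rfl⟩ := ModuleOrder.exists_vadd_sigMon_single_one K hT
  obtain ⟨-, d, -, hcov⟩ := (hs.unit_mem i).resolve_left fun h => hTH (h.vadd a)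
  obtain ⟨e, he, hmin⟩ := (InvImage.wf ord.toSyn wellFounded_lt).has_min
    {e | IsCovered f o G e (a +ᵥ o.sigMon (Pi.single i 1 : FreeMod σ K m))} ⟨_, hcov.vadd a⟩
  exact ⟨e, hTH, he, fun e' he' => not_lt.1 (hmin e' he')⟩

/-- Otherwise a multiple of the S-pair of the two elements involved has signature `T` and a lead
monomial smaller than `x ^ d`. -/
lemma Invariant.le_of_isLeastCovered (hs : Invariant f o (settledPairs f o) ⟨G, H, ∅⟩)
    (hT : IsLeastCovered f o G H d T) (hU : IsCovered f o G d U) : T ≤ U := by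
  obtain ⟨hTH, ⟨α, hα, hαd⟩, hmin⟩ := hT
  obtain ⟨β, hβ, hβd⟩ := hU
  have hα0 := hs.proj_ne_zero α hα
  have hβ0 := hs.proj_ne_zero β hβ
  obtain ⟨x, rfl, rfl, rfl⟩ := hαd.exists_vadd_sigMon_leg hβd hα0 hβ0
  by_contra! hlt
  have hleg := (o.vadd_strictMono x).lt_iff_lt.1 hlt
  have hreg : RegularPair f o α β := regularPair_iff.2 hleg.ne'
  have hsig : o.sigMon (sPair f ord α β) = o.sigMon (leg f ord α β) :=
    (sigMon_sPair hreg).trans (sup_eq_left.2 hleg.le)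
  have hset := hs.settled_sPair hα hβ hreg
  rw [Settled, hsig] at hset
  rcases hset with hdiv | ⟨h0, e, he, hcov⟩
  · exact hTH (hdiv.vadd x)
  · have hle := hmin _ (hcov.vadd x)
    rw [map_add, map_add, add_le_add_iff_left] at hle
    exact (he.trans_lt (degree_sPair_lt hα0 hβ0 h0)).not_ge hle

lemma Invariant.isCanonicalCover (hs : Invariant f o (settledPairs f o) ⟨G, H, ∅⟩) :
    IsCanonicalCover f o G H (IsLeastCovered f o G H) where
  isCovered h := h.2.1
  exists_of_not_sigDivisible := hs.exists_isLeastCovered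
  injective hT hU :=
    (hs.le_of_isLeastCovered hT hU.2.1).antisymm (hs.le_of_isLeastCovered hU hT.2.1)

theorem GenSBReturns.isSigBasisAt (h : GenSBReturns f o G H) (T : WithBot o.Mon) :
    IsSigBasisAt f o G T :=
  h.invariant.1.isCanonicalCover.isSigBasisAt h.invariant.1.proj_ne_zero
    h.invariant.1.proj_eq_zero T

end GenSB

section RB

variable {σ K : Type*} [Field K] {m : ℕ} {ord : MonomialOrder σ}

/-- A multiple of `α` of signature `T` is superseded: by a known syzygy, or by another element of
`G` that lies above `α` in the rewrite order. -/
def IsRewritten (o : ModuleOrder ord m) (r : FreeMod σ K m → FreeMod σ K m → Prop)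
    (G H : Set (FreeMod σ K m)) (T : WithBot o.Mon) (α : FreeMod σ K m) : Prop :=
  SigDivisible o H T ∨ ∃ η ∈ G, η ≠ α ∧ r α η ∧ ∃ b : σ →₀ ℕ, b +ᵥ o.sigMon η = T

/-- One of the two multiples in an S-pair is rewritten. In contrast to `Pair.Rewritable`, this
persists when `G` and `H` grow. -/
def Pair.IsLegRewritten (f : Fin m → MvPolynomial σ K) (o : ModuleOrder ord m)
    (r : FreeMod σ K m → FreeMod σ K m → Prop) (G H : Set (FreeMod σ K m)) : Pair σ K m → Prop
  | .unit _ => False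
  | .spair α β =>
      IsRewritten o r G H (o.sigMon (leg f ord α β)) α ∨
      IsRewritten o r G H (o.sigMon (leg f ord β α)) β

/-- The entries of the pair set that are rewritten or that reduce to an output element. -/
def rewrittenOrReducedPairs (f : Fin m → MvPolynomial σ K) (o : ModuleOrder ord m)
    (r : FreeMod σ K m → FreeMod σ K m → Prop) (s : Set (FreeMod σ K m) × Set (FreeMod σ K m)) :
    Set (Pair σ K m) :=
  {p | p.IsLegRewritten f o r s.1 s.2 ∨ ∃ γ ∈ s.1 ∪ s.2, Reduces f o s.1 (p.val f ord) γ}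

/-- `x ^ d` is the lead monomial of a multiple of signature `T` that is not rewritten. -/
def IsCanonicallyCovered (f : Fin m → MvPolynomial σ K) (o : ModuleOrder ord m)
    (r : FreeMod σ K m → FreeMod σ K m → Prop) (G H : Set (FreeMod σ K m)) (d : σ →₀ ℕ)
    (T : WithBot o.Mon) : Prop :=
  ∃ β ∈ G, Covers f o β d T ∧ ¬ IsRewritten o r G H T β

variable {f : Fin m → MvPolynomial σ K} {o : ModuleOrder ord m}
  {r : FreeMod σ K m → FreeMod σ K m → Prop} {s s' : State σ K m}
  {G G' H H' H₀ : Set (FreeMod σ K m)} {α β γ : FreeMod σ K m} {d : σ →₀ ℕ} {T U : WithBot o.Mon}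
  {p : Pair σ K m}

lemma IsRewritten.mono (hG : G ⊆ G') (hH : H ⊆ H') (h : IsRewritten o r G H T α) :
    IsRewritten o r G' H' T α :=
  h.imp (.mono hH) fun ⟨η, hη, h⟩ => ⟨η, hG hη, h⟩

lemma IsRewritten.vadd (x : σ →₀ ℕ) (h : IsRewritten o r G H T α) :
    IsRewritten o r G H (x +ᵥ T) α := by
  rcases h with h | ⟨η, hη, hne, hle, b, rfl⟩
  · exact .inl (h.vadd x)
  · exact .inr ⟨η, hη, hne, hle, x + b, add_vadd _ _ _⟩

lemma Pair.IsLegRewritten.mono (hG : G ⊆ G') (hH : H ⊆ H') (h : p.IsLegRewritten f o r G H) :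
    p.IsLegRewritten f o r G' H' := by
  cases p with
  | unit => exact h.elim
  | spair => exact h.imp (.mono hG hH) (.mono hG hH)

lemma monotone_rewrittenOrReducedPairs : Monotone (rewrittenOrReducedPairs f o r) :=
  fun _ _ hxy _ hp => hp.imp (.mono hxy.1 hxy.2) fun ⟨γ, hγ, h⟩ =>
    ⟨γ, Set.union_subset_union hxy.1 hxy.2 hγ, h.mono hxy.1⟩

lemma isRewritten_of_not_isCanonicalRewriter (hα : α ∈ G) (h0 : proj f α ≠ 0)
    (h : ¬ IsCanonicalRewriter o r G H (o.sig (leg f ord α β)) α) :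
    IsRewritten o r G H (o.sigMon (leg f ord α β)) α := by
  have hmem : α ∈ rewriters o G H (o.sig (leg f ord α β)) :=
    ⟨.inl hα, _, isMonomialMultiple_leg h0 β, rfl⟩
  rw [IsCanonicalRewriter, and_iff_right hmem] at h
  push Not at h
  obtain ⟨η, ⟨hη, bη, ⟨b, c, hc, rfl⟩, hsig⟩, hle, hne⟩ := h
  have hs : b +ᵥ o.sigMon η = o.sigMon (leg f ord α β) := by
    rw [← o.sigMon_monomial_smul η b hc, ← o.sigMon_sig, hsig, o.sigMon_sig]
  rcases hη with hη | hη
  · exact .inr ⟨η, hη, hne, hle, b, hs⟩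
  · exact .inl ⟨η, hη, b, hs⟩

lemma Pair.Rewritable.isLegRewritten (hs : Invariant f o (rewrittenOrReducedPairs f o r) s)
    (hp : p ∈ s.P) (h : p.Rewritable f o r s.G s.H) : p.IsLegRewritten f o r s.G s.H := by
  cases p with
  | unit => exact h.elim
  | spair α β =>
    obtain ⟨hα, hβ⟩ := hs.generators α β hp
    exact h.imp (isRewritten_of_not_isCanonicalRewriter hα (hs.proj_ne_zero α hα))
      (isRewritten_of_not_isCanonicalRewriter hβ (hs.proj_ne_zero β hβ))

lemma RBStep.invariant (h : RBStep f o r s s')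
    (hs : Invariant f o (rewrittenOrReducedPairs f o r) s) :
    Invariant f o (rewrittenOrReducedPairs f o r) s' := by
  cases h with
  | rewritten p hp hrew =>
    exact hs.discard monotone_rewrittenOrReducedPairs subset_rfl hs.proj_eq_zero
      (.inl (hrew.isLegRewritten hs hp.1))
  | syzygy p γ _ _ hγ h0 =>
    exact hs.addSyzygy monotone_rewrittenOrReducedPairs h0 (.inr ⟨γ, .inr (.inr rfl), hγ.1⟩)
  | basis p γ hp _ hγ h0 =>
    exact hs.addBasis monotone_rewrittenOrReducedPairs hp hγ h0
      (.inr ⟨γ, .inl (.inr rfl), Reduces.mono Set.subset_union_left hγ.1⟩)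

theorem invariant_of_reflTransGen_rbStep (hH₀ : ∀ η ∈ H₀, proj f η = 0)
    (h : Relation.ReflTransGen (RBStep f o r) ⟨∅, H₀, Set.range Pair.unit⟩ s) :
    Invariant f o (rewrittenOrReducedPairs f o r) s := by
  induction h with
  | refl => exact .start _ hH₀
  | tail _ h ih => exact h.invariant ih

lemma ne_of_degree_lt_of_sigMon_eq_leg (hα : proj f α ≠ 0)
    (hs : o.sigMon γ = o.sigMon (leg f ord α β))
    (hd : ord.degree (proj f γ) ≺[ord] ord.degree (proj f α) ⊔ ord.degree (proj f β)) :
    γ ≠ α := by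
  rintro rfl
  rw [sigMon_leg hα] at hs
  refine (ord.toSyn_monotone (tsub_eq_zero_iff_le.1 ?_)).not_gt hd
  by_contra hne
  exact (ModuleOrder.lt_vadd hne (sigMon_ne_bot_of_proj_ne_zero hα)).ne hs

lemma isRewritten_of_reduct (hα : proj f α ≠ 0) (hγ : γ ∈ G ∪ H)
    (hs : o.sigMon γ = o.sigMon (leg f ord α β))
    (hd : γ ∈ G → ord.degree (proj f γ) ≺[ord] ord.degree (proj f α) ⊔ ord.degree (proj f β))
    (hr : γ ∈ G → r α γ) : IsRewritten o r G H (o.sigMon (leg f ord α β)) α := by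
  rcases hγ with hγ | hγ
  · exact .inr ⟨γ, hγ, ne_of_degree_lt_of_sigMon_eq_leg hα hs (hd hγ), hr hγ, 0,
      (zero_vadd _ _).trans hs⟩
  · exact .inl ⟨γ, hγ, 0, (zero_vadd _ _).trans hs⟩

/-- If the S-pair was reduced instead of being discarded, then by admissibility the result rewrites
the multiple that carries the signature. -/
lemma isLegRewritten_of_mem (hadm : IsAdmissible f o r G) (hG : ∀ β ∈ G, proj f β ≠ 0)
    (hα : α ∈ G) (hβ : β ∈ G) (hreg : RegularPair f o α β)
    (h : .spair α β ∈ rewrittenOrReducedPairs f o r (G, H)) :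
    (Pair.spair α β).IsLegRewritten f o r G H := by
  rcases h with h | ⟨γ, hγ, hred⟩
  · exact h
  have hs := hred.sigMon_eq.trans (sigMon_sPair hreg)
  have hd : γ ∈ G → ord.degree (proj f γ) ≺[ord] ord.degree (proj f α) ⊔ ord.degree (proj f β) :=
    fun hγG => hred.degree_le.trans_lt
      (degree_sPair_lt (hG α hα) (hG β hβ) (hred.proj_ne_zero (hG γ hγG)))
  rcases lt_or_gt_of_ne (regularPair_iff.1 hreg) with hlt | hlt
  · rw [sup_comm] at hd
    exact .inr (isRewritten_of_reduct (hG β hβ) hγ (hs.trans (sup_eq_right.2 hlt.le)) hd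
      fun hγG => (hadm α hα β hβ γ hγG hreg hred).2 hlt)
  · exact .inl (isRewritten_of_reduct (hG α hα) hγ (hs.trans (sup_eq_left.2 hlt.le)) hd
      fun hγG => (hadm α hα β hβ γ hγG hreg hred).1 hlt)

lemma Invariant.isLegRewritten (hs : Invariant f o (rewrittenOrReducedPairs f o r) ⟨G, H, ∅⟩)
    (hadm : IsAdmissible f o r G) (hα : α ∈ G) (hβ : β ∈ G) (hreg : RegularPair f o α β) :
    (Pair.spair α β).IsLegRewritten f o r G H := by
  rcases hs.pair_mem hα hβ hreg with h | h
  · exact isLegRewritten_of_mem hadm hs.proj_ne_zero hα hβ hreg h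
  · exact (isLegRewritten_of_mem hadm hs.proj_ne_zero hβ hα hreg.symm h).symm

lemma exists_maximal_of_isPartialOrder {X : Type*} (r : X → X → Prop) [IsPartialOrder X r]
    {S : Set X} (hS : S.Finite) (hne : S.Nonempty) : ∃ x ∈ S, ∀ y ∈ S, r x y → y = x := by
  let _ : PartialOrder X :=
    { le := r
      le_refl := refl_of r
      le_trans := fun _ _ _ => trans_of r
      le_antisymm := fun _ _ => antisymm_of r }
  obtain ⟨x, hx⟩ := hS.exists_maximal hne
  exact ⟨x, hx.prop, fun y hy hxy => (hx.eq_of_le hy hxy).symm⟩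

lemma SigDivisible.exists_isCanonicallyCovered (h : SigDivisible o G T) (hG : G.Finite)
    (hr : IsPartialOrder G (Subrel r (· ∈ G))) (hTH : ¬ SigDivisible o H T) :
    ∃ d, IsCanonicallyCovered f o r G H d T := by
  obtain ⟨δ, hδ, c, hc⟩ := h
  have := hG.to_subtype
  obtain ⟨β, ⟨b, hb⟩, hmax⟩ := exists_maximal_of_isPartialOrder (Subrel r (· ∈ G))
    (S := {β | ∃ b : σ →₀ ℕ, b +ᵥ o.sigMon β.1 = T}) (Set.toFinite _) ⟨⟨δ, hδ⟩, c, hc⟩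
  refine ⟨_, β, β.2, ⟨b, rfl, hb⟩, ?_⟩
  rintro (hdiv | ⟨η, hη, hne, hle, hdiv⟩)
  · exact hTH hdiv
  · exact hne (congrArg Subtype.val (hmax ⟨η, hη⟩ hdiv hle))

lemma Invariant.exists_isCanonicallyCovered
    (hs : Invariant f o (rewrittenOrReducedPairs f o r) ⟨G, H, ∅⟩)
    (hr : IsPartialOrder G (Subrel r (· ∈ G))) (hT : T ≠ ⊥) (hTH : ¬ SigDivisible o H T) :
    ∃ d, IsCanonicallyCovered f o r G H d T := by
  obtain ⟨i, a, rfl⟩ := ModuleOrder.exists_vadd_sigMon_single_one K hT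
  obtain ⟨γ, hγ, hred⟩ := (hs.unit_mem i).resolve_left id
  have hdiv : a +ᵥ o.sigMon γ = a +ᵥ o.sigMon (Pi.single i 1 : FreeMod σ K m) :=
    congrArg _ hred.sigMon_eq
  rcases hγ with hγ | hγ
  · exact SigDivisible.exists_isCanonicallyCovered ⟨γ, hγ, a, hdiv⟩ hs.finite hr hTH
  · exact absurd ⟨γ, hγ, a, hdiv⟩ hTH

/-- Otherwise the two elements involved form a regular S-pair neither leg of which is rewritten. -/
lemma Invariant.eq_of_isCanonicallyCovered
    (hs : Invariant f o (rewrittenOrReducedPairs f o r) ⟨G, H, ∅⟩) (hadm : IsAdmissible f o r G)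
    (hT : IsCanonicallyCovered f o r G H d T) (hU : IsCanonicallyCovered f o r G H d U) :
    T = U := by
  obtain ⟨α, hα, hαd, hαT⟩ := hT
  obtain ⟨β, hβ, hβd, hβU⟩ := hU
  obtain ⟨x, -, rfl, rfl⟩ :=
    hαd.exists_vadd_sigMon_leg hβd (hs.proj_ne_zero α hα) (hs.proj_ne_zero β hβ)
  by_contra hne
  have hreg : RegularPair f o α β := regularPair_iff.2 fun h => hne (congrArg _ h)
  exact (hs.isLegRewritten hadm hα hβ hreg).elim (fun h => hαT (h.vadd x)) fun h => hβU (h.vadd x)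

lemma Invariant.isCanonicalCover_isCanonicallyCovered
    (hs : Invariant f o (rewrittenOrReducedPairs f o r) ⟨G, H, ∅⟩)
    (hr : IsPartialOrder G (Subrel r (· ∈ G))) (hadm : IsAdmissible f o r G) :
    IsCanonicalCover f o G H (IsCanonicallyCovered f o r G H) where
  isCovered := fun ⟨β, hβ, hcov, _⟩ => ⟨β, hβ, hcov⟩
  exists_of_not_sigDivisible := hs.exists_isCanonicallyCovered hr
  injective := hs.eq_of_isCanonicallyCovered hadm

lemma IsRewriteOrder.isPartialOrder (hr : IsRewriteOrder r G H) :
    IsPartialOrder G (Subrel r (· ∈ G)) where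
  refl α := hr.1 α (.inl α.2)
  trans α β γ := hr.2.2.1 α (.inl α.2) β (.inl β.2) γ (.inl γ.2)
  antisymm α β h h' := Subtype.ext (hr.2.1 α (.inl α.2) β (.inl β.2) h h')

end RB

section Comparison

variable {σ K : Type*} [Field K] {m : ℕ} {ord : MonomialOrder σ}
  {f : Fin m → MvPolynomial σ K} {o : ModuleOrder ord m} {G G' : Set (FreeMod σ K m)}
  {γ : FreeMod σ K m}

/-- The lead monomial of `γ` is covered by `G'`, and the covering element is in turn covered by `G`.
As `γ` is regular reduced and not singular top reducible, no signature drops on the way. -/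
lemma IsSingularReduced.exists_sigMon_eq (hsing : IsSingularReduced f o G)
    (hG : ∀ T, IsSigBasisAt f o G T) (hG' : ∀ T, IsSigBasisAt f o G' T)
    (hG'0 : ∀ β ∈ G', proj f β ≠ 0) (hγ : γ ∈ G) (h0 : proj f γ ≠ 0)
    (hred : ¬ IsRegularReducible f o G (ord.degree (proj f γ)) (o.sigMon γ)) :
    ∃ β ∈ G', o.sigMon γ = o.sigMon β := by
  obtain ⟨_, hs, β, hβ, b, hd, rfl⟩ := hG' _ γ rfl h0
  obtain ⟨S, hS, δ, hδ, hcov⟩ := hG _ β rfl (hG'0 β hβ)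
  have hle : b +ᵥ S ≤ o.sigMon γ := ((o.vadd_strictMono b).monotone hS).trans hs
  have hcov' : Covers f o δ (ord.degree (proj f γ)) (b +ᵥ S) := hd ▸ hcov.vadd b
  have heq : b +ᵥ S = o.sigMon γ := hle.eq_of_not_lt fun hlt => hred ⟨_, hlt, δ, hδ, hcov'⟩
  have hδγ : o.sigMon δ = o.sigMon γ := hsing γ hγ δ hδ (heq ▸ hcov')
  exact ⟨β, hβ, (hδγ.ge.trans (hcov.sigMon_le.trans hS)).antisymm ((o.le_vadd b _).trans hs)⟩

end Comparison

end SigGB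

end

theorem mainTheorem7_general {σ K : Type*} [Field K] {m : ℕ} {f : Fin m → MvPolynomial σ K}
    {ord : MonomialOrder σ} {o : SigGB.ModuleOrder ord m}
    {r : SigGB.FreeMod σ K m → SigGB.FreeMod σ K m → Prop}
    {G H G' H' H₀ : Set (SigGB.FreeMod σ K m)} (hgenSB : SigGB.GenSBReturns f o G H)
    (hH₀ : ∀ η ∈ H₀, SigGB.proj f η = 0)
    (hRB : Relation.ReflTransGen (SigGB.RBStep f o r)
      ⟨∅, H₀, Set.range SigGB.Pair.unit⟩ ⟨G', H', ∅⟩)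
    (hr : IsPartialOrder G' (Subrel r (· ∈ G'))) (hadm : SigGB.IsAdmissible f o r G') :
    ∀ α ∈ G, ∃ β ∈ G', SigGB.EqUpToSigPoly f o α β := by
  intro α hα
  obtain ⟨inv, hsing⟩ := hgenSB.invariant
  have inv' := SigGB.invariant_of_reflTransGen_rbStep hH₀ hRB
  have hG := hgenSB.isSigBasisAt
  have hG' := (inv'.isCanonicalCover_isCanonicallyCovered hr hadm).isSigBasisAt
    inv'.proj_ne_zero inv'.proj_eq_zero
  have h0 := inv.proj_ne_zero α hα
  have hirr := inv.irreducible α hα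
  obtain ⟨β, hβ, hs⟩ := hsing.exists_sigMon_eq hG hG' inv'.proj_ne_zero hα h0
    (hirr _ (ord.degree_mem_support h0))
  exact ⟨β, hβ, SigGB.eqUpToSigPoly_of_irreducible hG hG' hs
    (SigGB.sigMon_ne_bot_of_proj_ne_zero h0) hirr (inv'.irreducible β hβ)⟩

theorem mainTheorem7 {σ : Type*} [Finite σ] {K : Type*} [Field K] {m : ℕ}
    (f : Fin m → MvPolynomial σ K) (ord : MonomialOrder σ) (o : SigGB.ModuleOrder ord m)
    (r : SigGB.FreeMod σ K m → SigGB.FreeMod σ K m → Prop)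
    (G H G' H' : Set (SigGB.FreeMod σ K m))
    (hgenSB : SigGB.GenSBReturns f o G H)
    (hRB : SigGB.RBReturns f o r G' H')
    (hr : SigGB.IsRewriteOrder r G' H')
    (hadm : SigGB.IsAdmissible f o r G') :
    ∀ α ∈ G, ∃ β ∈ G', SigGB.EqUpToSigPoly f o α β :=
  mainTheorem7_general hgenSB (fun _ => SigGB.proj_eq_zero_of_mem_koszulSyzygies f) hRB
    hr.isPartialOrder hadm
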